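/- Let $q,s\ge 0$ be integers, let $V_1,\dots,V_s\in\mathbb Z^q$ be fixed vectors that are linearly independent over $\mathbb R$, let $\mathcal L\subseteq\mathbb R^q$ be their linear span, and fix $\tau>0$. For $\lambda=(\lambda_1,\dots,\lambda_q)\in[0,\infty)^q$ put $\nu=\sum_i\lambda_i$ and $D=\mathrm{diag}(\sqrt{\lambda_1},\dots,\sqrt{\lambda_q})$. Call $\lambda$ admissible if $\nu>0$, $\min_i\lambda_i\ge\tau\nu$ and $\mathbb Z^q\cap(\lambda\oplus\mathcal L)\neq\emptyset$, where $\lambda\oplus\mathcal L=\{\lambda+x:x\in\mathcal L\}$. Let $$B_0=\Big\{\sum_{\alpha\le s}t_\alpha V_\alpha:\ 0\le t_\alpha<1\Big\},\qquad \kappa_V=\#(\mathbb Z^q\cap B_0),$$ $$\gamma(\lambda)=(2\pi)^{s/2}\prod_{i\le q}\Big(\frac{2\pi\lambda_i}{\nu}\Big)^{-1/2},\qquad \mu(\lambda)=\nu^{s/2}\,\mathrm{Leb}_\lambda(D^{-1}B_0),\qquad \beta(\lambda)=\frac{\kappa_V\,\gamma(\lambda)}{\mu(\lambda)},$$ where $\mathrm{Leb}_\lambda$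 is Lebesgue measure on the $s$-dimensional Euclidean subspace $D^{-1}\mathcal L$ of $\mathbb R^q$. Let $Y=(Y_1,\dots,Y_q)$ be a vector of independent random variables with $Y_i\sim\mathrm{Poisson}(\lambda_i)$. (a) There are constants $0<c\le C<\infty$, depending only on $V_1,\dots,V_s$ and $\tau$, such that $c\le\beta(\lambda)\le C$ for every admissible $\lambda$. Moreover $$\mathbb P\{Y\in\lambda\oplus\mathcal L\}=\nu^{-(q-s)/2}\big(\beta(\lambda)+o(1)\big)$$ as $\nu\to\infty$ over admissible $\lambda$, where the $o(1)$ is uniform over all admissible $\lambda$ with the given total $\nu$ (for fixed $V_1,\dots,V_s$ and $\tau$). (b) For every fixed integer $k\ge1$ there is a constant $b_k>0$ such that, if $n$ is a multiple of $k$, $Y=(Y_{ij})_{1\le i,j\le k}$ has independent entries $Y_{ij}\sim\mathrm{Poisson}(n/k^2)$, and $\mathcal H_k$ is the set of $k\times k$ matrices of nonnegative integers all of whose row sums and column sums equal $n/k$, then $$n^{(2k-1)/2}\,\mathbb P\{Y\in\mathcal H_k\}\to b_k\qquad\text{as } n\to\infty,\ k\mid n.$$ In particular $\mathbb P\{Y\in\mathcal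 H_k\}$ is of exact order $n^{-(2k-1)/2}$. -/

import Mathlib

open MeasureTheory ProbabilityTheory Filter Topology
open scoped NNReal

namespace CondPoisson

noncomputable section

variable {ι Ω : Type*} [Fintype ι] [DecidableEq ι] {s : ℕ}

/-- The family `Y` consists of independent random variables on `(Ω, P)` and `Y i` has the
Poisson distribution with mean `lam i`. -/
def IsIndepPoisson {ι Ω : Type*} [MeasurableSpace Ω] (P : Measure Ω) (Y : ι → Ω → ℕ)
    (lam : ι → ℝ≥0) : Prop :=
  (∀ i, HasLaw (Y i) (poissonMeasure (lam i)) P) ∧ iIndepFun Y P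

/-- The total mean `ν = ∑ i, λ_i`. -/
def total (lam : ι → ℝ≥0) : ℝ := ∑ i, (lam i : ℝ)

/-- The vector of means, as a point of Euclidean space. -/
def meanVec (lam : ι → ℝ≥0) : EuclideanSpace ℝ ι := WithLp.toLp 2 fun i => (lam i : ℝ)

/-- An integer vector, as a point of Euclidean space. -/
def intVec (m : ι → ℤ) : EuclideanSpace ℝ ι := WithLp.toLp 2 fun i => (m i : ℝ)

/-- A vector of counts, as a point of Euclidean space. -/
def natVec (m : ι → ℕ) : EuclideanSpace ℝ ι := WithLp.toLp 2 fun i => (m i : ℝ)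

/-- The subspace `L` spanned by the integer vectors `V_1, …, V_s`. -/
def spanV (V : Fin s → ι → ℤ) : Submodule ℝ (EuclideanSpace ℝ ι) :=
  Submodule.span ℝ (Set.range fun a => intVec (V a))

/-- The affine subspace `λ ⊕ L`. -/
def plane (lam : ι → ℝ≥0) (V : Fin s → ι → ℤ) : Set (EuclideanSpace ℝ ι) :=
  {y | ∃ x ∈ spanV V, y = meanVec lam + x}

/-- The standing assumptions on the vector of means: `ν > 0`, `min_i λ_i ≥ τ ν`, and
`λ ⊕ L` contains an integer point. (The inequality `ν ≥ max_i λ_i` is automatic.) -/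
def Admissible (τ : ℝ) (V : Fin s → ι → ℤ) (lam : ι → ℝ≥0) : Prop :=
  0 < total lam ∧ (∀ i, τ * total lam ≤ (lam i : ℝ)) ∧ ∃ m : ι → ℤ, intVec m ∈ plane lam V

/-- The box `B_0 = {∑ a, t_a V_a : ⌊t_a⌋ = 0}`. -/
def box (V : Fin s → ι → ℤ) : Set (EuclideanSpace ℝ ι) :=
  {x | ∃ t : Fin s → ℝ, (∀ a, ⌊t a⌋ = 0) ∧ x = ∑ a, t a • intVec (V a)}

/-- `κ_V`, the number of points of `ℤ^ι` in the box `B_0`. -/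
def kappa (V : Fin s → ι → ℤ) : ℕ := {m : ι → ℤ | intVec m ∈ box V}.ncard

/-- The linear map `D⁻¹`, where `D = diag(√λ_i)`. -/
def Dinv (lam : ι → ℝ≥0) : EuclideanSpace ℝ ι →ₗ[ℝ] EuclideanSpace ℝ ι :=
  Matrix.toEuclideanLin (Matrix.diagonal fun i => (√(lam i : ℝ))⁻¹)

/-- The subspace `D⁻¹ L`. -/
def scaledSpan (lam : ι → ℝ≥0) (V : Fin s → ι → ℤ) : Submodule ℝ (EuclideanSpace ℝ ι) :=
  (spanV V).map (Dinv lam)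

/-- The Lebesgue measure of `D⁻¹ B_0` in the Euclidean space `D⁻¹ L`. -/
def lebBox (lam : ι → ℝ≥0) (V : Fin s → ι → ℤ) : ℝ :=
  (volume : Measure (scaledSpan lam V)).real
    {x | (x : EuclideanSpace ℝ ι) ∈ Dinv lam '' box V}

/-- `μ(λ)`, determined by `Leb (D⁻¹ B_0) = ν^(-s/2) μ(λ)`. -/
def mu (lam : ι → ℝ≥0) (V : Fin s → ι → ℤ) : ℝ :=
  total lam ^ ((s : ℝ) / 2) * lebBox lam V

/-- `γ(λ) = (2π)^(s/2) ∏ i, (2π λ_i / ν)^(-1/2)`. -/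
def gam (s : ℕ) (lam : ι → ℝ≥0) : ℝ :=
  (2 * Real.pi) ^ ((s : ℝ) / 2) *
    ∏ i, (2 * Real.pi * (lam i : ℝ) / total lam) ^ (-(1 / 2) : ℝ)

/-- `β(λ) = κ_V γ(λ) / μ(λ)`. -/
def beta (lam : ι → ℝ≥0) (V : Fin s → ι → ℤ) : ℝ :=
  (kappa V : ℝ) * gam s lam / mu lam V

/-- `H_k`: the `k × k` tables of nonnegative integers all of whose row sums and column sums
equal `n / k`. -/
def tables (k n : ℕ) : Set (Fin k × Fin k → ℕ) :=
  {T | (∀ i, ∑ j, (T (i, j) : ℝ) = (n : ℝ) / k) ∧ (∀ j, ∑ i, (T (i, j) : ℝ) = (n : ℝ) / k)}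

end

end CondPoisson

/-! ### Poisson point masses: uniform bound, tail bound and local limit. -/

namespace CondPoisson

noncomputable section

/-! The integer points of `λ ⊕ L` form `κ_V` translates of the lattice generated by `V`, one for
each integer point of the half-open box. On each translate the probability is a lattice sum of
products of Poisson masses. Since the floor map carries Lebesgue measure on `ℝ^s` to counting
measure, the sum is exactly an integral of a step function, and rescaling by `√ν` gives the integral
of `scaledMass`.

Pointwise, the one-dimensional Poisson local limit theorem (`tendsto_sqrt_mul_poissonMass`) brings
`scaledMass` close to a product of Gaussian densities with variances `λ_i / ν`. An exponential tail
bound (`poissonMass_le_tail`), obtained by tilting, dominates both functions by a multiple of `exp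
(-a‖u‖)`. Dominated convergence then makes the integrals agree asymptotically. The Gaussian integral
is computed in the Euclidean space `D⁻¹ L`; times `κ_V` it equals `β(λ)` (`beta_eq`). As `λ_i / ν`
lies in `[τ, 1]`, this formula also bounds `β`.

Uniformity costs nothing: all limits are taken along the filter `ν → ∞` on admissible `λ`, and only
differences are shown to vanish, so `λ / ν` need not converge.

For tables, `L` is the space of matrices with zero row and column sums, of dimension `(k - 1)^2`.
For constant `λ` the value of `β` does not depend on the constant, so it is the limit `b_k`. -/

/-- The mass at the integer `m` of the Poisson distribution with mean `a`. -/
def poissonMass (a : ℝ) (m : ℤ) : ℝ :=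
  if 0 ≤ m then Real.exp (-a) * a ^ m.toNat / (m.toNat).factorial else 0

lemma poissonMass_natCast (a : ℝ) (n : ℕ) :
    poissonMass a n = Real.exp (-a) * a ^ n / n.factorial := by
  simp [poissonMass]

lemma poissonMass_of_neg (a : ℝ) {m : ℤ} (hm : m < 0) : poissonMass a m = 0 := by
  simp [poissonMass, not_le.2 hm]

lemma poissonMass_nonneg {a : ℝ} (ha : 0 ≤ a) (m : ℤ) : 0 ≤ poissonMass a m := by
  unfold poissonMass
  split_ifs <;> positivity

/-- The ratio of consecutive terms is `a / (j + 1)`, which is at least 1 up to the floor of `a` and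
at most 1 beyond it, so the mode is the floor. -/
lemma pow_div_factorial_le_floor {a : ℝ} (ha : 0 ≤ a) (m : ℕ) :
    a ^ m / m.factorial ≤ a ^ ⌊a⌋₊ / (⌊a⌋₊).factorial := by
  have hna : (⌊a⌋₊ : ℝ) ≤ a := Nat.floor_le ha
  have han : a ≤ (⌊a⌋₊ : ℝ) + 1 := (Nat.lt_floor_add_one a).le
  generalize ⌊a⌋₊ = n at hna han ⊢
  rw [div_le_div_iff₀ (by positivity) (by positivity)]
  rcases le_total m n with h | h
  · obtain ⟨k, rfl⟩ := Nat.exists_eq_add_of_le h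
    have h1 : ((m + k).factorial : ℝ) ≤ m.factorial * a ^ k := by
      have h2 := Nat.factorial_mul_descFactorial (Nat.le_add_left k m)
      rw [Nat.add_sub_cancel] at h2
      rw [← h2, Nat.cast_mul]
      gcongr
      calc (((m + k).descFactorial k : ℕ) : ℝ) ≤ (((m + k) ^ k : ℕ) : ℝ) := by
            exact_mod_cast Nat.descFactorial_le_pow _ _
        _ ≤ a ^ k := by
            push_cast
            push_cast at hna
            gcongr
    calc a ^ m * (m + k).factorial ≤ a ^ m * (m.factorial * a ^ k) := by gcongr
      _ = a ^ (m + k) * m.factorial := by ring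
  · obtain ⟨k, rfl⟩ := Nat.exists_eq_add_of_le h
    have h1 : (n.factorial : ℝ) * a ^ k ≤ (n + k).factorial := by
      calc (n.factorial : ℝ) * a ^ k ≤ n.factorial * (n + 1) ^ k := by gcongr
        _ ≤ (n + k).factorial := by exact_mod_cast Nat.factorial_mul_pow_le_factorial
    calc a ^ (n + k) * n.factorial = a ^ n * (n.factorial * a ^ k) := by ring
      _ ≤ a ^ n * (n + k).factorial := by gcongr

/-- At the mode `n = ⌊a⌋`, the inequality `x ≤ exp (x - 1)` with `x = a / n` bounds `exp (-a) * a ^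
n` by `(n / e) ^ n`, and Stirling's lower bound for `n!` supplies the factor `√(2πn) ≥ √a`. -/
lemma poissonMass_le_inv_sqrt {a : ℝ} (ha : 1 ≤ a) (m : ℤ) : poissonMass a m ≤ (√a)⁻¹ := by
  rcases lt_or_ge m 0 with hm | hm
  · rw [poissonMass_of_neg a hm]; positivity
  lift m to ℕ using hm
  rw [poissonMass_natCast, mul_div_assoc]
  have ha0 : 0 < a := by linarith
  refine (mul_le_mul_of_nonneg_left (pow_div_factorial_le_floor ha0.le m)
    (Real.exp_pos _).le).trans ?_
  set n := ⌊a⌋₊ with hn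
  have hn1 : 1 ≤ n := by rw [hn]; exact Nat.le_floor (by simpa using ha)
  have hn1' : (1 : ℝ) ≤ n := by exact_mod_cast hn1
  have hn0 : (0 : ℝ) < n := by linarith
  have han : a ≤ (n : ℝ) + 1 := (Nat.lt_floor_add_one a).le
  have h1 : Real.exp (-a) * a ^ n ≤ ((n : ℝ) / Real.exp 1) ^ n := by
    have h2 : a / n ≤ Real.exp (a / n - 1) := by
      have := Real.add_one_le_exp (a / n - 1); linarith
    have h3 : (a / n) ^ n ≤ Real.exp (a - n) := by
      calc (a / n) ^ n ≤ (Real.exp (a / n - 1)) ^ n := by gcongr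
        _ = Real.exp (a - n) := by
            rw [← Real.exp_nat_mul]; congr 1; field_simp
    rw [div_pow, div_le_iff₀ (by positivity)] at h3
    rw [div_pow, ← Real.exp_nat_mul, mul_one, le_div_iff₀ (Real.exp_pos _)]
    calc Real.exp (-a) * a ^ n * Real.exp n
        ≤ Real.exp (-a) * (Real.exp (a - n) * n ^ n) * Real.exp n := by gcongr
      _ = (Real.exp (-a) * Real.exp (a - n) * Real.exp n) * n ^ n := by ring
      _ = n ^ n := by rw [← Real.exp_add, ← Real.exp_add]; ring_nf; simp
  have h4 := Stirling.le_factorial_stirling n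
  have h5 : √a ≤ √(2 * Real.pi * n) := by
    apply Real.sqrt_le_sqrt
    nlinarith [Real.pi_gt_three]
  have h6 : 0 < ((n : ℝ) / Real.exp 1) ^ n := by positivity
  rw [← mul_div_assoc, div_le_iff₀ (by positivity), ← div_eq_inv_mul, le_div_iff₀ (by positivity)]
  calc Real.exp (-a) * a ^ n * √a ≤ ((n : ℝ) / Real.exp 1) ^ n * √(2 * Real.pi * n) := by gcongr
    _ ≤ n.factorial := by rw [mul_comm]; exact h4

/-- Exponential change of measure: it will turn the uniform bound for mean `a * exp θ` into a tail
bound for mean `a`. -/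
lemma poissonMass_tilt (a θ : ℝ) (m : ℤ) :
    poissonMass a m = poissonMass (a * Real.exp θ) m *
      Real.exp (a * (Real.exp θ - 1 - θ)) * Real.exp (-(θ * (m - a))) := by
  rcases lt_or_ge m 0 with hm | hm
  · simp [poissonMass_of_neg _ hm]
  lift m to ℕ using hm
  rw [poissonMass_natCast, poissonMass_natCast, mul_pow, ← Real.exp_nat_mul]
  have : Real.exp (-a) = Real.exp (-(a * Real.exp θ)) * Real.exp (m * θ) *
      Real.exp (a * (Real.exp θ - 1 - θ)) * Real.exp (-(θ * (m - a))) := by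
    rw [← Real.exp_add, ← Real.exp_add, ← Real.exp_add]; congr 1; ring
  rw [this, Int.cast_natCast]; ring

/-- Tilt by `θ = ±1/√a`, with the sign of `m - a`: the normalizing factor is then at most `e`,
because `exp θ - 1 - θ ≤ θ ^ 2`. The condition `9 ≤ a` ensures that the tilted mean is at least 1,
since `e ^ 2 ≤ 9`. -/
lemma poissonMass_le_tail {a : ℝ} (ha : 9 ≤ a) (m : ℤ) :
    √a * poissonMass a m ≤ Real.exp 2 * Real.exp (-(|m - a| / √a)) := by
  have ha0 : 0 < a := by linarith
  have hsa : 0 < √a := Real.sqrt_pos.2 ha0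
  have hsa1 : 1 ≤ √a := Real.one_le_sqrt.2 (by linarith)
  have key : ∀ θ : ℝ, |θ| = 1 / √a →
      √a * poissonMass a m ≤ Real.exp 2 * Real.exp (-(θ * (m - a))) := by
    intro θ hθ
    have hθ1 : |θ| ≤ 1 := by rw [hθ, div_le_one hsa]; exact hsa1
    have h1 : a * (Real.exp θ - 1 - θ) ≤ 1 := by
      have h2 : Real.exp θ - 1 - θ ≤ θ ^ 2 :=
        (le_abs_self _).trans (Real.abs_exp_sub_one_sub_id_le hθ1)
      have h3 : θ ^ 2 = 1 / a := by
        rw [← sq_abs, hθ, div_pow, Real.sq_sqrt ha0.le, one_pow]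
      calc a * (Real.exp θ - 1 - θ) ≤ a * (1 / a) := by rw [← h3]; gcongr
        _ = 1 := by field_simp
    have h4 : Real.exp (-1) ≤ Real.exp θ := by
      apply Real.exp_le_exp.2; linarith [neg_abs_le θ]
    have he2 : Real.exp 1 * Real.exp 1 ≤ 9 := by
      nlinarith [Real.exp_one_lt_three, Real.exp_pos 1]
    -- The weaker bound `e⁻²` in place of `e⁻¹` makes the square root in `h8` explicit.
    have h5 : a * (Real.exp (-1) * Real.exp (-1)) ≤ a * Real.exp θ := by
      have : Real.exp (-1) ≤ 1 := Real.exp_le_one_iff.2 (by norm_num)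
      have := Real.exp_pos (-1)
      gcongr
      nlinarith
    have h6 : 1 ≤ a * Real.exp θ := by
      refine le_trans ?_ h5
      rw [Real.exp_neg, ← mul_inv, ← div_eq_mul_inv, le_div_iff₀ (by positivity)]
      linarith
    have h7 : √a * (√(a * Real.exp θ))⁻¹ ≤ Real.exp 1 := by
      rw [← div_eq_mul_inv, div_le_iff₀ (Real.sqrt_pos.2 (by linarith))]
      have h8 : √(a * (Real.exp (-1) * Real.exp (-1))) ≤ √(a * Real.exp θ) :=
        Real.sqrt_le_sqrt h5
      rw [Real.sqrt_mul ha0.le, Real.sqrt_mul_self (Real.exp_pos _).le] at h8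
      calc √a = Real.exp 1 * (√a * Real.exp (-1)) := by
            rw [mul_left_comm, ← Real.exp_add]; simp
        _ ≤ _ := by gcongr
    have h9 : (0 : ℝ) ≤ poissonMass (a * Real.exp θ) m := poissonMass_nonneg (by positivity) m
    rw [poissonMass_tilt a θ m]
    calc √a * (poissonMass (a * Real.exp θ) m * Real.exp (a * (Real.exp θ - 1 - θ)) *
          Real.exp (-(θ * (m - a))))
        ≤ √a * ((√(a * Real.exp θ))⁻¹ * Real.exp 1 * Real.exp (-(θ * (m - a)))) := by
          gcongr
          exact poissonMass_le_inv_sqrt h6 m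
      _ = √a * (√(a * Real.exp θ))⁻¹ * Real.exp 1 * Real.exp (-(θ * (m - a))) := by ring
      _ ≤ Real.exp 1 * Real.exp 1 * Real.exp (-(θ * (m - a))) := by gcongr
      _ = Real.exp 2 * Real.exp (-(θ * (m - a))) := by rw [← Real.exp_add]; norm_num
  have hab : |1 / √a| = 1 / √a := abs_of_pos (by positivity)
  rcases abs_cases ((m : ℝ) - a) with ⟨h, -⟩ | ⟨h, -⟩
  · have := key (1 / √a) hab
    rw [h]
    convert this using 4
    ring
  · have := key (-(1 / √a)) (by rw [abs_neg, hab])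
    rw [h]
    convert this using 4
    ring

lemma abs_one_add_mul_log_le {δ : ℝ} (h : |δ| ≤ 1 / 2) :
    |(1 + δ) * Real.log (1 + δ) - δ - δ ^ 2 / 2| ≤ 4 * |δ| ^ 3 := by
  have h1 := Real.abs_log_sub_add_sum_range_le (x := -δ) (by rw [abs_neg]; linarith) 2
  simp only [Finset.sum_range_succ, Finset.sum_range_zero, abs_neg, sub_neg_eq_add] at h1
  norm_num at h1
  set R := Real.log (1 + δ) - δ + δ ^ 2 / 2 with hR
  have h2 : |R| ≤ 2 * |δ| ^ 3 := by
    have : |δ| ^ 3 / (1 - |δ|) ≤ 2 * |δ| ^ 3 := by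
      rw [div_le_iff₀ (by linarith)]
      nlinarith [pow_nonneg (abs_nonneg δ) 3]
    refine le_trans (le_of_eq ?_) (h1.trans this)
    rw [hR]; congr 1; ring
  have h3 : (1 + δ) * Real.log (1 + δ) - δ - δ ^ 2 / 2 = -(δ ^ 3 / 2) + (1 + δ) * R := by
    rw [hR]; ring
  rw [h3]
  have h4 : |1 + δ| ≤ 3 / 2 := by
    refine (abs_add_le _ _).trans ?_
    rw [abs_one]; linarith
  calc |-(δ ^ 3 / 2) + (1 + δ) * R| ≤ |-(δ ^ 3 / 2)| + |(1 + δ) * R| := abs_add_le _ _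
    _ = |δ| ^ 3 / 2 + |1 + δ| * |R| := by
        rw [abs_neg, abs_div, abs_pow, abs_mul, abs_two]
    _ ≤ |δ| ^ 3 / 2 + 3 / 2 * (2 * |δ| ^ 3) := by gcongr
    _ ≤ 4 * |δ| ^ 3 := by nlinarith [pow_nonneg (abs_nonneg δ) 3]

/-- Stirling's formula in exact form: `stirlingSeq` tends to `√π`, so near `n = a` only the entropy
exponent matters, and `abs_one_add_mul_log_le` expands it. -/
lemma sqrt_mul_poissonMass_eq {a : ℝ} (ha : 0 < a) {n : ℕ} (hn : n ≠ 0) :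
    √a * poissonMass a n = √Real.pi / Stirling.stirlingSeq n * √(a / n) *
      Real.exp (-(a * ((n / a) * Real.log (n / a) - (n / a - 1)))) / √(2 * Real.pi) := by
  have hn0 : (0 : ℝ) < n := by exact_mod_cast Nat.pos_of_ne_zero hn
  have h1 : Real.exp (-(a * ((n / a) * Real.log (n / a) - (n / a - 1)))) =
      Real.exp (-a) * Real.exp n * (a / n) ^ n := by
    rw [← Real.exp_log (show 0 < a / n by positivity), ← Real.exp_nat_mul, ← Real.exp_add,
      ← Real.exp_add, show a / (n : ℝ) = ((n : ℝ) / a)⁻¹ by rw [inv_div], Real.log_inv]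
    congr 1
    field_simp
    ring
  have h2 : Stirling.stirlingSeq n = n.factorial / (√(2 * n) * (n / Real.exp 1) ^ n) := rfl
  rw [h1, h2, poissonMass_natCast, div_pow, div_pow, ← Real.exp_nat_mul, mul_one,
    Real.sqrt_mul (by norm_num), Real.sqrt_mul (by norm_num), Real.sqrt_div ha.le]
  have h3 : 0 < √Real.pi := Real.sqrt_pos.2 Real.pi_pos
  have h4 : 0 < √(n : ℝ) := Real.sqrt_pos.2 hn0
  field_simp

/-- The local limit theorem for the Poisson distribution. -/
lemma tendsto_sqrt_mul_poissonMass {α : Type*} {l : Filter α} {a x : α → ℝ} {m : α → ℤ} {K : ℝ}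
    (ha : Tendsto a l atTop) (hx : ∀ᶠ i in l, |x i| ≤ K)
    (hm : Tendsto (fun i => ((m i : ℝ) - a i) / √(a i) - x i) l (𝓝 0)) :
    Tendsto (fun i => √(a i) * poissonMass (a i) (m i) -
      Real.exp (-(x i ^ 2 / 2)) / √(2 * Real.pi)) l (𝓝 0) := by
  set z : α → ℝ := fun i => ((m i : ℝ) - a i) / √(a i) with hz
  have hsq : Tendsto (fun i => √(a i)) l atTop := Real.tendsto_sqrt_atTop.comp ha
  have ha0 : ∀ᶠ i in l, 0 < a i := ha.eventually_gt_atTop 0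
  have hzK : ∀ᶠ i in l, |z i| ≤ K + 1 := by
    filter_upwards [hx, hm.eventually (Metric.ball_mem_nhds 0 one_pos)] with i h1 h2
    have h2' : |z i - x i| < 1 := by simpa [Real.dist_eq] using h2
    have := abs_sub_abs_le_abs_sub (z i) (x i)
    linarith
  have hz3 : ∀ p : ℕ, Tendsto (fun i => |z i| ^ p / √(a i)) l (𝓝 0) := by
    intro p
    refine squeeze_zero' (Eventually.of_forall fun i => by positivity)
      (hzK.mono fun i hi => ?_) (hsq.const_div_atTop ((K + 1) ^ p))
    gcongr
  have hδ : Tendsto (fun i => z i / √(a i)) l (𝓝 0) := by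
    rw [tendsto_zero_iff_abs_tendsto_zero]
    refine (hz3 1).congr fun i => ?_
    simp [Function.comp, abs_div, abs_of_nonneg (Real.sqrt_nonneg _)]
  have hma : ∀ᶠ i in l, (m i : ℝ) / a i = 1 + z i / √(a i) := by
    filter_upwards [ha0] with i hi
    have : √(a i) * √(a i) = a i := Real.mul_self_sqrt hi.le
    rw [hz]
    simp only
    rw [div_div, this]
    field_simp
    ring
  have hma1 : Tendsto (fun i => (m i : ℝ) / a i) l (𝓝 1) := by
    have : Tendsto (fun i => 1 + z i / √(a i)) l (𝓝 1) := by simpa using hδ.const_add 1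
    exact this.congr' (hma.mono fun i hi => hi.symm)
  have hmtop : Tendsto (fun i => (m i : ℝ)) l atTop := by
    refine (ha.atTop_mul_pos one_pos hma1).congr' ?_
    filter_upwards [ha0] with i hi
    field_simp
  have hm0 : ∀ᶠ i in l, 0 < m i := by
    filter_upwards [hmtop.eventually_gt_atTop 0] with i hi
    exact_mod_cast hi
  have hntop : Tendsto (fun i => (m i).toNat) l atTop := by
    rw [← tendsto_natCast_atTop_iff (R := ℝ)]
    refine hmtop.congr' ?_
    filter_upwards [hm0] with i hi
    exact_mod_cast (Int.toNat_of_nonneg hi.le).symm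
  have hstir : Tendsto (fun i => √Real.pi / Stirling.stirlingSeq (m i).toNat) l (𝓝 1) := by
    have h0 : √Real.pi ≠ 0 := (Real.sqrt_pos.2 Real.pi_pos).ne'
    have := (tendsto_const_nhds (x := √Real.pi)).div
      (Stirling.tendsto_stirlingSeq_sqrt_pi.comp hntop) h0
    rwa [div_self h0] at this
  have hroot : Tendsto (fun i => √(a i / m i)) l (𝓝 1) := by
    have := (hma1.inv₀ one_ne_zero).sqrt
    rw [inv_one, Real.sqrt_one] at this
    refine this.congr fun i => ?_
    rw [inv_div]
  set E : α → ℝ := fun i =>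
    -(a i * ((m i / a i) * Real.log (m i / a i) - (m i / a i - 1))) with hE
  have hE0 : Tendsto (fun i => E i + x i ^ 2 / 2) l (𝓝 0) := by
    have h1 : Tendsto (fun i => E i + z i ^ 2 / 2) l (𝓝 0) := by
      rw [tendsto_zero_iff_abs_tendsto_zero]
      refine squeeze_zero' (Eventually.of_forall fun i => abs_nonneg _) ?_
        (by simpa using (hz3 3).const_mul 4)
      filter_upwards [hma, ha0, hδ.eventually (Metric.ball_mem_nhds 0 one_half_pos)]
        with i h1 h2 h3
      have h3' : |z i / √(a i)| ≤ 1 / 2 := by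
        have : |z i / √(a i)| < 1 / 2 := by
          rwa [Real.dist_0_eq_abs] at h3
        exact this.le
      have h4 := abs_one_add_mul_log_le h3'
      have hs : 0 < √(a i) := Real.sqrt_pos.2 h2
      have h5 : a i = √(a i) ^ 2 := (Real.sq_sqrt h2.le).symm
      have h6 : E i + z i ^ 2 / 2 = -(a i * ((1 + z i / √(a i)) * Real.log (1 + z i / √(a i))
          - z i / √(a i) - (z i / √(a i)) ^ 2 / 2)) := by
        have h7 : a i * (z i / √(a i)) ^ 2 = z i ^ 2 := by
          rw [div_pow, Real.sq_sqrt h2.le]; field_simp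
        rw [hE]
        simp only
        rw [h1, ← h7]
        ring
      simp only [Function.comp]
      rw [h6, abs_neg, abs_mul, abs_of_pos h2]
      calc a i * _ ≤ a i * (4 * |z i / √(a i)| ^ 3) := by gcongr
        _ = 4 * (|z i| ^ 3 / √(a i)) := by
            rw [abs_div, abs_of_pos hs, div_pow]
            nth_rw 1 [h5]
            field_simp
    have h2 : Tendsto (fun i => (z i - x i) * (z i + x i)) l (𝓝 0) := by
      refine hm.zero_mul_isBoundedUnder_le ?_
      refine ⟨K + 1 + K, ?_⟩
      rw [eventually_map]
      filter_upwards [hx, hzK] with i h1 h2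
      simp only [Function.comp, Real.norm_eq_abs]
      exact (abs_add_le _ _).trans (by linarith)
    have h3 := h1.sub (h2.div_const 2)
    simp only [zero_div, sub_zero] at h3
    refine h3.congr fun i => ?_
    ring
  have hexp : Tendsto (fun i => Real.exp (E i + x i ^ 2 / 2)) l (𝓝 1) := by
    simpa [Function.comp_def] using (Real.continuous_exp.tendsto 0).comp hE0
  -- The rescaled mass is the Gaussian density times these three factors, so the difference is a
  -- null factor times a bounded one. Boundedness of `x` suffices.
  have hA := ((hstir.mul hroot).mul hexp).sub_const 1
  simp only [mul_one, sub_self] at hA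
  have hfin := hA.zero_mul_isBoundedUnder_le
    (g := fun i => Real.exp (-(x i ^ 2 / 2)) / √(2 * Real.pi)) ⟨1 / √(2 * Real.pi), by
      rw [eventually_map]
      refine Eventually.of_forall fun i => ?_
      simp only [Function.comp, Real.norm_eq_abs]
      rw [abs_of_nonneg (by positivity)]
      gcongr
      exact Real.exp_le_one_iff.2 (by nlinarith [sq_nonneg (x i)])⟩
  refine hfin.congr' ?_
  filter_upwards [ha0, hm0] with i h1 h2
  have h3 : m i = ((m i).toNat : ℤ) := (Int.toNat_of_nonneg h2.le).symm
  have h4 : (m i).toNat ≠ 0 := by omega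
  have h5 : ((m i).toNat : ℝ) = m i := by exact_mod_cast h3.symm
  have h6 := sqrt_mul_poissonMass_eq h1 h4
  rw [← h3, h5] at h6
  rw [h6]
  have h7 : Real.exp (-(a i * ((m i / a i) * Real.log (m i / a i) - (m i / a i - 1)))) =
      Real.exp (E i + x i ^ 2 / 2) * Real.exp (-(x i ^ 2 / 2)) := by
    rw [← Real.exp_add]; simp [hE]
  rw [h7]
  ring

end

end CondPoisson

/-! ### Integer points of the plane in lattice coordinates. -/

namespace CondPoisson

noncomputable section

variable {ι : Type*} {s : ℕ}

/-- The real linear combination `∑ a, u a • V a`. -/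
def comb (V : Fin s → ι → ℤ) : (Fin s → ℝ) →ₗ[ℝ] (ι → ℝ) where
  toFun u i := ∑ a, u a * (V a i : ℝ)
  map_add' u v := by ext i; simp [add_mul, Finset.sum_add_distrib]
  map_smul' c u := by ext i; simp [Finset.mul_sum, mul_assoc]

/-- The integer linear combination `∑ a, z a • V a`. -/
def latticeVec (V : Fin s → ι → ℤ) (z : Fin s → ℤ) : ι → ℤ := fun i => ∑ a, z a * V a i

lemma comb_apply (V : Fin s → ι → ℤ) (u : Fin s → ℝ) (i : ι) :
    comb V u i = ∑ a, u a * (V a i : ℝ) := rfl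

lemma cast_latticeVec (V : Fin s → ι → ℤ) (z : Fin s → ℤ) (i : ι) :
    (latticeVec V z i : ℝ) = comb V (fun a => (z a : ℝ)) i := by
  simp [latticeVec, comb_apply]

lemma sum_smul_intVec (V : Fin s → ι → ℤ) (u : Fin s → ℝ) :
    ∑ a, u a • intVec (V a) = WithLp.toLp 2 (comb V u) := by
  ext i
  simp [intVec, comb_apply]

lemma comb_injective {V : Fin s → ι → ℤ}
    (hV : LinearIndependent ℝ (fun a => intVec (V a))) : Function.Injective (comb V) := by
  intro u v huv
  rw [Fintype.linearIndependent_iff] at hV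
  have h := hV (u - v) (by rw [sum_smul_intVec, map_sub, huv, sub_self]; rfl)
  funext a
  have := h a
  simpa [sub_eq_zero] using this

lemma mem_spanV_iff {V : Fin s → ι → ℤ} {x : EuclideanSpace ℝ ι} :
    x ∈ spanV V ↔ ∃ u, x = WithLp.toLp 2 (comb V u) := by
  rw [spanV, Submodule.mem_span_range_iff_exists_fun]
  simp_rw [sum_smul_intVec, eq_comm]

lemma intVec_mem_plane_iff {V : Fin s → ι → ℤ} {lam : ι → ℝ≥0} {m : ι → ℤ} :
    intVec m ∈ plane lam V ↔ ∃ u, ∀ i, (m i : ℝ) = lam i + comb V u i := by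
  constructor
  · rintro ⟨x, hx, h⟩
    obtain ⟨u, rfl⟩ := mem_spanV_iff.1 hx
    refine ⟨u, fun i => ?_⟩
    simpa [intVec, meanVec] using congrArg (fun y : EuclideanSpace ℝ ι => y i) h
  · rintro ⟨u, h⟩
    refine ⟨_, mem_spanV_iff.2 ⟨u, rfl⟩, ?_⟩
    ext i
    simpa [intVec, meanVec] using h i

lemma intVec_mem_box_iff {V : Fin s → ι → ℤ} {m : ι → ℤ} :
    intVec m ∈ box V ↔ ∃ t : Fin s → ℝ, (∀ a, ⌊t a⌋ = 0) ∧ ∀ i, (m i : ℝ) = comb V t i := by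
  simp only [box, Set.mem_ofPred_eq, sum_smul_intVec]
  refine exists_congr fun t => and_congr_right fun _ => ?_
  constructor
  · intro h i
    simpa [intVec] using congrArg (fun y : EuclideanSpace ℝ ι => y i) h
  · intro h
    ext i
    simpa [intVec] using h i

/-- The integer points of the half-open box spanned by `V`. -/
def boxPoints (V : Fin s → ι → ℤ) : Set (ι → ℤ) := {m | intVec m ∈ box V}

lemma boxPoints_finite [Fintype ι] (V : Fin s → ι → ℤ) : (boxPoints V).Finite := by
  classical
  refine (Set.finite_Icc (fun i => -∑ a, |V a i|) (fun i => ∑ a, |V a i|)).subset ?_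
  intro m hm
  obtain ⟨t, ht, h⟩ := intVec_mem_box_iff.1 hm
  have key : ∀ i, |m i| ≤ ∑ a, |V a i| := by
    intro i
    have : |(m i : ℝ)| ≤ ∑ a, |(V a i : ℝ)| := by
      rw [h i, comb_apply]
      refine (Finset.abs_sum_le_sum_abs _ _).trans (Finset.sum_le_sum fun a _ => ?_)
      have h0 := Int.floor_eq_zero_iff.1 (ht a)
      rw [abs_mul, abs_of_nonneg h0.1]
      exact mul_le_of_le_one_left (abs_nonneg _) h0.2.le
    exact_mod_cast this
  exact ⟨fun i => (abs_le.1 (key i)).1, fun i => (abs_le.1 (key i)).2⟩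

lemma boxPoints_nonempty (V : Fin s → ι → ℤ) : (0 : ι → ℤ) ∈ boxPoints V :=
  intVec_mem_box_iff.2 ⟨0, by simp, by simp⟩

lemma kappa_eq [Fintype ι] (V : Fin s → ι → ℤ) : kappa V = (boxPoints_finite V).toFinset.card :=
  Set.ncard_eq_toFinset_card _ _

/-- The points `m + r + ∑ a, z a • V a`, which for `r` in the box run through the integer points
of a translate of the span. -/
def cosetPoint (V : Fin s → ι → ℤ) (m : ι → ℤ) (p : boxPoints V × (Fin s → ℤ)) : ι → ℤ :=
  m + p.1 + latticeVec V p.2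

/-- Box coordinates lie in `[0, 1)`, so the floors of the real coordinates recover `z`, and then `r`
is determined. -/
lemma cosetPoint_injective {V : Fin s → ι → ℤ}
    (hV : LinearIndependent ℝ (fun a => intVec (V a))) (m : ι → ℤ) :
    Function.Injective (cosetPoint V m) := by
  rintro ⟨⟨r, hr⟩, z⟩ ⟨⟨r', hr'⟩, z'⟩ h
  obtain ⟨t, ht, hrt⟩ := intVec_mem_box_iff.1 hr
  obtain ⟨t', ht', hrt'⟩ := intVec_mem_box_iff.1 hr'
  have h1 : comb V (t + fun a => (z a : ℝ)) = comb V (t' + fun a => (z' a : ℝ)) := by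
    ext i
    have h2 := congrFun h i
    simp only [cosetPoint, Pi.add_apply] at h2
    have h3 : (r i : ℝ) + latticeVec V z i = r' i + latticeVec V z' i := by
      have : r i + latticeVec V z i = r' i + latticeVec V z' i := by linarith
      exact_mod_cast this
    rw [map_add, map_add, Pi.add_apply, Pi.add_apply, ← hrt, ← hrt', ← cast_latticeVec,
      ← cast_latticeVec, h3]
  have h4 := comb_injective hV h1
  have hz : z = z' := by
    funext a
    have h5 : t a + (z a : ℝ) = t' a + (z' a : ℝ) := congrFun h4 a
    have h6 := congrArg Int.floor h5
    simpa [ht a, ht' a] using h6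
  subst hz
  have hr0 : r = r' := by
    have : cosetPoint V m (⟨r, hr⟩, z) = cosetPoint V m (⟨r', hr'⟩, z) := h
    simpa [cosetPoint] using this
  subst hr0
  rfl

/-- Split the real coordinates of `n - m` into integer parts, giving the lattice vector, and
fractional parts, giving the box point. -/
lemma range_cosetPoint {V : Fin s → ι → ℤ} {lam : ι → ℝ≥0} {m : ι → ℤ}
    (hm : intVec m ∈ plane lam V) :
    Set.range (cosetPoint V m) = {n | intVec n ∈ plane lam V} := by
  obtain ⟨u, hu⟩ := intVec_mem_plane_iff.1 hm
  ext n
  constructor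
  · rintro ⟨⟨⟨r, hr⟩, z⟩, rfl⟩
    obtain ⟨t, ht, hrt⟩ := intVec_mem_box_iff.1 hr
    refine intVec_mem_plane_iff.2 ⟨u + t + fun a => (z a : ℝ), fun i => ?_⟩
    simp only [cosetPoint, Pi.add_apply, map_add, Int.cast_add, hu, hrt, cast_latticeVec]
    ring
  · intro hn
    obtain ⟨v, hv⟩ := intVec_mem_plane_iff.1 hn
    set w : Fin s → ℝ := v - u with hw
    set z : Fin s → ℤ := fun a => ⌊w a⌋ with hz
    have hr : n - m - latticeVec V z ∈ boxPoints V := by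
      refine intVec_mem_box_iff.2 ⟨fun a => Int.fract (w a), by simp, fun i => ?_⟩
      have h1 : (fun a => Int.fract (w a)) = v - u - fun a => (z a : ℝ) := by
        funext a; exact (Int.self_sub_floor _).symm
      rw [h1, map_sub, map_sub]
      simp only [Pi.sub_apply, Int.cast_sub, hu, hv, cast_latticeVec]
      ring
    exact ⟨(⟨_, hr⟩, z), show m + (n - m - latticeVec V z) + latticeVec V z = n by abel⟩

/-- Each floor cell has volume 1, so Lebesgue measure pushes forward to counting measure. This
replaces any Riemann sum estimate. -/
lemma lintegral_comp_floor (f : (Fin s → ℤ) → ENNReal) :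
    ∫⁻ u : Fin s → ℝ, f (fun a => ⌊u a⌋) = ∑' z, f z := by
  have hmeas : Measurable (fun (u : Fin s → ℝ) (a : Fin s) => ⌊u a⌋) :=
    measurable_pi_lambda _ fun a => Int.measurable_floor.comp (measurable_pi_apply a)
  have hmap : (volume : Measure (Fin s → ℝ)).map (fun u a => ⌊u a⌋) = Measure.count := by
    refine Measure.ext_of_singleton fun z => ?_
    rw [Measure.map_apply hmeas (measurableSet_singleton z), Measure.count_singleton]
    have : (fun (u : Fin s → ℝ) (a : Fin s) => ⌊u a⌋) ⁻¹' {z} =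
        Set.univ.pi fun a => Set.Ico (z a : ℝ) (z a + 1) := by
      ext u
      simp [funext_iff, Int.floor_eq_iff]
    rw [this, volume_pi_pi]
    simp
  rw [← lintegral_count, ← hmap, lintegral_map (measurable_of_countable f) hmeas]

/-! ### The probability of the plane as an integral. -/

section Law

variable [Fintype ι] {Ω : Type*} [MeasurableSpace Ω] {P : Measure Ω} {Y : ι → Ω → ℕ}
  {lam : ι → ℝ≥0}

lemma poissonMeasure_cast_eq (a : ℝ≥0) (m : ℤ) :
    poissonMeasure a {n : ℕ | (n : ℤ) = m} = ENNReal.ofReal (poissonMass a m) := by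
  rcases lt_or_ge m 0 with hm | hm
  · rw [poissonMass_of_neg _ hm]
    have : {n : ℕ | (n : ℤ) = m} = ∅ := by
      ext n; simp; omega
    simp [this]
  · lift m to ℕ using hm
    have : {n : ℕ | (n : ℤ) = m} = {m} := by ext n; simp
    rw [this, poissonMeasure_singleton, poissonMass_natCast]

lemma IsIndepPoisson.measure_eq (h : IsIndepPoisson P Y lam) (m : ι → ℤ) :
    P {ω | (fun i => (Y i ω : ℤ)) = m} = ∏ i, ENNReal.ofReal (poissonMass (lam i) (m i)) := by
  have h1 := h.2.measure_inter_preimage_eq_mul Finset.univ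
    (sets := fun i => {n : ℕ | (n : ℤ) = m i}) (fun i _ => MeasurableSet.of_discrete)
  have h2 : {ω | (fun i => (Y i ω : ℤ)) = m} =
      ⋂ i ∈ Finset.univ, Y i ⁻¹' {n : ℕ | (n : ℤ) = m i} := by
    ext ω; simp [funext_iff]
  rw [h2, h1]
  refine Finset.prod_congr rfl fun i _ => ?_
  rw [← poissonMeasure_cast_eq]
  exact (h.1 i).measure_eq (p := fun n => (n : ℤ) = m i) MeasurableSet.of_discrete

lemma IsIndepPoisson.measure_plane (h : IsIndepPoisson P Y lam) {V : Fin s → ι → ℤ}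
    (hV : LinearIndependent ℝ (fun a => intVec (V a))) {m : ι → ℤ}
    (hm : intVec m ∈ plane lam V) :
    P {ω | natVec (fun i => Y i ω) ∈ plane lam V} =
      ∑ r ∈ (boxPoints_finite V).toFinset, ∫⁻ u : Fin s → ℝ,
        ENNReal.ofReal (∏ i, poissonMass (lam i)
          (m i + r i + latticeVec V (fun a => ⌊u a⌋) i)) := by
  have hX : AEMeasurable (fun ω i => (Y i ω : ℤ)) P :=
    aemeasurable_pi_lambda _ fun i =>
      (measurable_of_countable (fun n : ℕ => (n : ℤ))).comp_aemeasurable (h.1 i).aemeasurable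
  have h1 : {ω | natVec (fun i => Y i ω) ∈ plane lam V} =
      (fun ω i => (Y i ω : ℤ)) ⁻¹' {n | intVec n ∈ plane lam V} := by
    ext ω; simp [natVec, intVec]
  have h2 : {n | intVec n ∈ plane lam V} = ⋃ p, {cosetPoint V m p} := by
    rw [← range_cosetPoint hm]; ext n; simp [eq_comm]
  have := (boxPoints_finite V).fintype
  rw [h1, ← Measure.map_apply_of_aemeasurable hX MeasurableSet.of_discrete, h2,
    measure_iUnion (fun p p' hp => Set.disjoint_singleton.2 ((cosetPoint_injective hV m).ne hp))
      (fun _ => MeasurableSet.of_discrete), ENNReal.tsum_prod', tsum_fintype]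
  rw [Finset.sum_subtype _ (fun r => (boxPoints_finite V).mem_toFinset)]
  refine Finset.sum_congr rfl fun r _ => ?_
  rw [lintegral_comp_floor (fun z => ENNReal.ofReal (∏ i, poissonMass (lam i)
          (m i + r.1 i + latticeVec V z i)))]
  refine tsum_congr fun z => ?_
  rw [Measure.map_apply_of_aemeasurable hX MeasurableSet.of_discrete,
    ENNReal.ofReal_prod_of_nonneg fun i _ => poissonMass_nonneg (by positivity) _]
  exact h.measure_eq _

lemma IsIndepPoisson.measureReal_plane [IsProbabilityMeasure P] (h : IsIndepPoisson P Y lam)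
    {V : Fin s → ι → ℤ} (hV : LinearIndependent ℝ (fun a => intVec (V a))) {m : ι → ℤ}
    (hm : intVec m ∈ plane lam V) :
    P.real {ω | natVec (fun i => Y i ω) ∈ plane lam V} =
      ∑ r ∈ (boxPoints_finite V).toFinset, ∫ u : Fin s → ℝ,
        ∏ i, poissonMass (lam i) (m i + r i + latticeVec V (fun a => ⌊u a⌋) i) := by
  have h1 := h.measure_plane hV hm
  have hfin : ∀ r ∈ (boxPoints_finite V).toFinset, ∫⁻ u : Fin s → ℝ,
        ENNReal.ofReal (∏ i, poissonMass (lam i)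
          (m i + r i + latticeVec V (fun a => ⌊u a⌋) i)) ≠ ⊤ := by
    intro r hr
    refine ne_top_of_le_ne_top (measure_ne_top P
      {ω | natVec (fun i => Y i ω) ∈ plane lam V}) ?_
    rw [h1]
    exact Finset.single_le_sum (f := fun r : ι → ℤ => ∫⁻ u : Fin s → ℝ,
        ENNReal.ofReal (∏ i, poissonMass (lam i)
          (m i + r i + latticeVec V (fun a => ⌊u a⌋) i))) (fun _ _ => zero_le) hr
  rw [measureReal_def, h1, ENNReal.toReal_sum hfin]
  refine Finset.sum_congr rfl fun r _ => ?_
  rw [integral_eq_lintegral_of_nonneg_ae]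
  · exact Eventually.of_forall fun u =>
      Finset.prod_nonneg fun i _ => poissonMass_nonneg (by positivity) _
  · have hmeas : Measurable (fun (u : Fin s → ℝ) (a : Fin s) => ⌊u a⌋) :=
      measurable_pi_lambda _ fun a => Int.measurable_floor.comp (measurable_pi_apply a)
    exact ((measurable_of_countable (fun z : Fin s → ℤ => ∏ i, poissonMass (lam i)
      (m i + r i + latticeVec V z i))).comp hmeas).aestronglyMeasurable

end Law

end

end CondPoisson

/-! ### Gaussian integrals and bounds for `β`. -/

namespace CondPoisson

noncomputable section

variable {ι : Type*} [Fintype ι] {s : ℕ}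

/-- An injective linear map in finite dimension is bounded below. This turns decay in each
coordinate of `ℝ^ι` into decay in `u`. -/
lemma exists_mul_norm_le_sum_abs_comb {V : Fin s → ι → ℤ}
    (hV : LinearIndependent ℝ (fun a => intVec (V a))) :
    ∃ a : ℝ, 0 < a ∧ ∀ u, a * ‖u‖ ≤ ∑ i, |comb V u i| := by
  obtain ⟨K, hK, h⟩ := (comb V).exists_antilipschitzWith
    (LinearMap.ker_eq_bot.2 (comb_injective hV))
  have hK' : (0 : ℝ) < K := hK
  refine ⟨(K : ℝ)⁻¹, inv_pos.2 hK', fun u => ?_⟩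
  have h1 := h.le_mul_dist u 0
  rw [map_zero, dist_zero_right, dist_zero_right] at h1
  have h2 : ‖comb V u‖ ≤ ∑ i, |comb V u i| :=
    (pi_norm_le_iff_of_nonneg (Finset.sum_nonneg fun i _ => abs_nonneg _)).2 fun i =>
      Finset.single_le_sum (f := fun i => |comb V u i|) (fun i _ => abs_nonneg _)
        (Finset.mem_univ i)
  rw [inv_mul_le_iff₀ hK']
  exact h1.trans (by gcongr)

lemma integrable_exp_neg_mul_norm {a : ℝ} (ha : 0 < a) :
    Integrable (fun u : Fin s → ℝ => Real.exp (-(a * ‖u‖))) := by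
  have h1 : Integrable (fun u : Fin s → ℝ => (1 + ‖u‖) ^ (-((s + 1 : ℕ) : ℝ))) :=
    integrable_one_add_norm (by simp)
  refine (h1.const_mul (Real.exp a * (s + 1).factorial / a ^ (s + 1))).mono'
    (by fun_prop) (Eventually.of_forall fun u => ?_)
  rw [Real.norm_eq_abs, Real.abs_exp, Real.rpow_neg (by positivity), Real.rpow_natCast]
  have h2 := Real.pow_div_factorial_le_exp (a * (1 + ‖u‖)) (by positivity) (s + 1)
  have h3 : Real.exp (-(a * ‖u‖)) = Real.exp a * (Real.exp (a * (1 + ‖u‖)))⁻¹ := by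
    rw [← Real.exp_neg, ← Real.exp_add]; congr 1; ring
  have h4 : Real.exp a * (s + 1).factorial / a ^ (s + 1) * ((1 + ‖u‖) ^ (s + 1))⁻¹ =
      Real.exp a * ((a * (1 + ‖u‖)) ^ (s + 1) / (s + 1).factorial)⁻¹ := by
    rw [mul_pow]; field_simp
  rw [h3, h4]
  gcongr

/-- The density, in the coordinates given by `V`, of the centred Gaussian law whose coordinates
are independent with variances `p i`. -/
def gaussDensity (p : ι → ℝ) (V : Fin s → ι → ℤ) (u : Fin s → ℝ) : ℝ :=
  ∏ i, Real.exp (-((comb V u i / √(p i)) ^ 2 / 2)) / √(2 * Real.pi) / √(p i)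

lemma gaussDensity_pos {p : ι → ℝ} (hp : ∀ i, 0 < p i) (V : Fin s → ι → ℤ) (u : Fin s → ℝ) :
    0 < gaussDensity p V u :=
  Finset.prod_pos fun i _ => by
    have := Real.sqrt_pos.2 (hp i)
    positivity

lemma continuous_gaussDensity (p : ι → ℝ) (V : Fin s → ι → ℤ) :
    Continuous (gaussDensity p V) := by
  unfold gaussDensity
  simp only [comb_apply]
  fun_prop

/-- From `(|x| - 1) ^ 2 ≥ 0` one gets `exp (-x²/2) ≤ exp (1/2 - |x|)`. The resulting bound depends
on `p` only through `τ` and `M`. -/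
lemma gaussDensity_le {τ M : ℝ} (hτ : 0 < τ) {p : ι → ℝ} (hp : ∀ i, τ ≤ p i)
    (hpM : ∀ i, p i ≤ M) {V : Fin s → ι → ℤ} {a : ℝ}
    (ha : ∀ u, a * ‖u‖ ≤ ∑ i, |comb V u i|) (u : Fin s → ℝ) :
    gaussDensity p V u ≤
      (Real.exp (1 / 2) / √τ) ^ Fintype.card ι * Real.exp (-(a / √M * ‖u‖)) := by
  have hsτ : 0 < √τ := Real.sqrt_pos.2 hτ
  have h1 : ∀ i, Real.exp (-((comb V u i / √(p i)) ^ 2 / 2)) / √(2 * Real.pi) / √(p i) ≤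
      Real.exp (1 / 2) / √τ * Real.exp (-(|comb V u i| / √M)) := by
    intro i
    have hpi : 0 < p i := hτ.trans_le (hp i)
    have hsp : 0 < √(p i) := Real.sqrt_pos.2 hpi
    have h2 : Real.exp (-((comb V u i / √(p i)) ^ 2 / 2)) ≤
        Real.exp (1 / 2) * Real.exp (-(|comb V u i| / √M)) := by
      rw [← Real.exp_add]
      apply Real.exp_le_exp.2
      have h3 : |comb V u i| / √M ≤ |comb V u i / √(p i)| := by
        rw [abs_div, abs_of_pos hsp]
        gcongr
        exact hpM i
      have h4 := sq_abs (comb V u i / √(p i))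
      nlinarith [sq_nonneg (|comb V u i / √(p i)| - 1)]
    have h5 : 1 ≤ √(2 * Real.pi) := Real.one_le_sqrt.2 (by linarith [Real.pi_gt_three])
    calc Real.exp (-((comb V u i / √(p i)) ^ 2 / 2)) / √(2 * Real.pi) / √(p i)
        ≤ Real.exp (-((comb V u i / √(p i)) ^ 2 / 2)) / √(p i) := by
          gcongr
          exact div_le_self (Real.exp_pos _).le h5
      _ ≤ Real.exp (1 / 2) * Real.exp (-(|comb V u i| / √M)) / √τ := by
          gcongr
          exact hp i
      _ = _ := by ring
  calc gaussDensity p V u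
      ≤ ∏ i, (Real.exp (1 / 2) / √τ * Real.exp (-(|comb V u i| / √M))) :=
        Finset.prod_le_prod (fun i _ => by positivity) fun i _ => h1 i
    _ = (Real.exp (1 / 2) / √τ) ^ Fintype.card ι * Real.exp (-((∑ i, |comb V u i|) / √M)) := by
        rw [Finset.prod_mul_distrib, Finset.prod_const, ← Real.exp_sum, Finset.sum_neg_distrib,
          Finset.sum_div, Finset.card_univ]
    _ ≤ _ := by
        gcongr
        rw [div_mul_eq_mul_div]
        gcongr
        exact ha u

lemma integrable_gaussDensity {τ M : ℝ} (hτ : 0 < τ) (hM : 0 < M) {p : ι → ℝ}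
    (hp : ∀ i, τ ≤ p i) (hpM : ∀ i, p i ≤ M) {V : Fin s → ι → ℤ}
    (hV : LinearIndependent ℝ (fun a => intVec (V a))) : Integrable (gaussDensity p V) := by
  obtain ⟨a, ha0, ha⟩ := exists_mul_norm_le_sum_abs_comb hV
  have hMs : 0 < √M := Real.sqrt_pos.2 hM
  refine ((integrable_exp_neg_mul_norm (s := s) (div_pos ha0 hMs)).const_mul
    ((Real.exp (1 / 2) / √τ) ^ Fintype.card ι)).mono'
    (continuous_gaussDensity p V).aestronglyMeasurable (Eventually.of_forall fun u => ?_)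
  rw [Real.norm_eq_abs, abs_of_pos (gaussDensity_pos (fun i => hτ.trans_le (hp i)) V u)]
  exact gaussDensity_le hτ hp hpM ha u

lemma integral_gaussDensity_pos {τ M : ℝ} (hτ : 0 < τ) (hM : 0 < M) {p : ι → ℝ}
    (hp : ∀ i, τ ≤ p i) (hpM : ∀ i, p i ≤ M) {V : Fin s → ι → ℤ}
    (hV : LinearIndependent ℝ (fun a => intVec (V a))) : 0 < ∫ u, gaussDensity p V u := by
  have h0 : ∀ u, 0 < gaussDensity p V u :=
    gaussDensity_pos (fun i => hτ.trans_le (hp i)) V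
  exact integral_pos_of_integrable_nonneg_nonzero (x := 0) (continuous_gaussDensity p V)
    (integrable_gaussDensity hτ hM hp hpM hV) (fun u => (h0 u).le) (h0 0).ne'

lemma coe_le_total (lam : ι → ℝ≥0) (i : ι) : (lam i : ℝ) ≤ total lam :=
  Finset.single_le_sum (f := fun i => (lam i : ℝ)) (fun i _ => (lam i).2) (Finset.mem_univ i)

section Volume

variable [DecidableEq ι]

lemma Dinv_apply (lam : ι → ℝ≥0) (x : EuclideanSpace ℝ ι) (i : ι) :
    Dinv lam x i = (√(lam i : ℝ))⁻¹ * x i := by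
  simp [Dinv, Matrix.toLpLin_apply, Matrix.mulVec_diagonal]

lemma Dinv_injective {lam : ι → ℝ≥0} (hlam : ∀ i, (0 : ℝ) < lam i) :
    Function.Injective (Dinv lam) := by
  intro x y h
  ext i
  have h1 := congrArg (fun z : EuclideanSpace ℝ ι => z i) h
  simp only [Dinv_apply] at h1
  exact mul_left_cancel₀ (inv_ne_zero (Real.sqrt_pos.2 (hlam i)).ne') h1

/-- The parametrization of `D⁻¹ L` by the coordinates with respect to `D⁻¹ V`. -/
def scaledCoord (V : Fin s → ι → ℤ) (lam : ι → ℝ≥0) : (Fin s → ℝ) →ₗ[ℝ] scaledSpan lam V :=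
  ((Dinv lam).comp ((WithLp.linearEquiv 2 ℝ (ι → ℝ)).symm.toLinearMap.comp
    (comb V))).codRestrict (scaledSpan lam V) fun u =>
      Submodule.mem_map_of_mem (mem_spanV_iff.2 ⟨u, rfl⟩)

lemma coe_scaledCoord (V : Fin s → ι → ℤ) (lam : ι → ℝ≥0) (u : Fin s → ℝ) :
    (scaledCoord V lam u : EuclideanSpace ℝ ι) = Dinv lam (WithLp.toLp 2 (comb V u)) := rfl

lemma scaledCoord_bijective {V : Fin s → ι → ℤ}
    (hV : LinearIndependent ℝ (fun a => intVec (V a))) {lam : ι → ℝ≥0}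
    (hlam : ∀ i, (0 : ℝ) < lam i) : Function.Bijective (scaledCoord V lam) := by
  constructor
  · intro u v h
    have h1 := congrArg Subtype.val h
    rw [coe_scaledCoord, coe_scaledCoord] at h1
    exact comb_injective hV (WithLp.toLp_injective 2 (Dinv_injective hlam h1))
  · rintro ⟨x, y, hy, rfl⟩
    obtain ⟨u, rfl⟩ := mem_spanV_iff.1 hy
    exact ⟨u, rfl⟩

lemma norm_sq_scaledCoord (V : Fin s → ι → ℤ) (lam : ι → ℝ≥0) (u : Fin s → ℝ) :
    ‖scaledCoord V lam u‖ ^ 2 = ∑ i, comb V u i ^ 2 / lam i := by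
  rw [Submodule.coe_norm, coe_scaledCoord, EuclideanSpace.real_norm_sq_eq]
  refine Finset.sum_congr rfl fun i _ => ?_
  rw [Dinv_apply, mul_pow, inv_pow, Real.sq_sqrt (NNReal.coe_nonneg _)]
  ring

/-- By uniqueness of Haar measure, volume on `D⁻¹ L` is `c` times the image of Lebesgue measure in
`V`-coordinates. The box corresponds to the unit cube, so `c` is `lebBox`; the rest is the Gaussian
integral on a Euclidean space. No Gram determinant is needed. -/
lemma lebBox_mul_integral {V : Fin s → ι → ℤ}
    (hV : LinearIndependent ℝ (fun a => intVec (V a))) {lam : ι → ℝ≥0}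
    (hlam : ∀ i, (0 : ℝ) < lam i) {b : ℝ} (hb : 0 < b) :
    lebBox lam V * ∫ u : Fin s → ℝ, Real.exp (-b * ∑ i, comb V u i ^ 2 / lam i) =
      (Real.pi / b) ^ ((s : ℝ) / 2) := by
  set e : (Fin s → ℝ) ≃L[ℝ] scaledSpan lam V :=
    (LinearEquiv.ofBijective _ (scaledCoord_bijective hV hlam)).toContinuousLinearEquiv with he
  have hecoe : ∀ u, e u = scaledCoord V lam u := fun u => rfl
  set ρ : Measure (scaledSpan lam V) := volume.map e with hρ
  have : ρ.IsAddHaarMeasure := e.isAddHaarMeasure_map volume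
  obtain ⟨c, hc⟩ : ∃ c : ℝ≥0, (volume : Measure (scaledSpan lam V)) = c • ρ :=
    ⟨_, Measure.isAddLeftInvariant_eq_smul volume ρ⟩
  have hemb : MeasurableEmbedding e := e.toHomeomorph.measurableEmbedding
  have hleb : lebBox lam V = c := by
    have hpre : e ⁻¹' {x | (x : EuclideanSpace ℝ ι) ∈ Dinv lam '' box V} =
        Set.univ.pi fun _ => Set.Ico (0 : ℝ) 1 := by
      ext u
      simp only [Set.mem_preimage, Set.mem_ofPred_eq, hecoe, coe_scaledCoord,
        (Dinv_injective hlam).mem_set_image, Set.mem_pi, Set.mem_univ, true_implies]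
      rw [box, Set.mem_ofPred_eq]
      simp_rw [sum_smul_intVec]
      constructor
      · rintro ⟨t, ht, h⟩ a
        rw [comb_injective hV (WithLp.toLp_injective 2 h)]
        exact Int.floor_eq_zero_iff.1 (ht a)
      · intro h
        exact ⟨u, fun a => Int.floor_eq_zero_iff.2 (h a), rfl⟩
    rw [lebBox, hc, measureReal_def, Measure.smul_apply, hρ, hemb.map_apply, hpre, volume_pi_pi]
    simp
  have hint := GaussianFourier.integral_rexp_neg_mul_sq_norm (V := scaledSpan lam V) hb
  rw [← (LinearEquiv.ofBijective _ (scaledCoord_bijective hV hlam)).finrank_eq,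
    Module.finrank_fin_fun, hc, integral_smul_nnreal_measure, hρ, hemb.integral_map] at hint
  simp_rw [hecoe, norm_sq_scaledCoord] at hint
  rw [hleb, ← hint]
  rfl

/-- `β(λ)` as a Gaussian integral. -/
lemma beta_eq {V : Fin s → ι → ℤ}
    (hV : LinearIndependent ℝ (fun a => intVec (V a))) {lam : ι → ℝ≥0}
    (hlam : ∀ i, (0 : ℝ) < lam i) (hν : 0 < total lam) :
    beta lam V = kappa V * ∫ u, gaussDensity (fun i => (lam i : ℝ) / total lam) V u := by
  set ν := total lam with hνdef
  -- With `b = ν / 2` the exponent is that of the Gaussian with variances `λ_i / ν`.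
  have h1 := lebBox_mul_integral hV hlam (b := ν / 2) (by positivity)
  have hpos : 0 < (Real.pi / (ν / 2)) ^ ((s : ℝ) / 2) := by positivity
  have hleb : lebBox lam V ≠ 0 := by
    rintro h
    rw [h, zero_mul] at h1
    exact hpos.ne h1
  have h2 : ∀ u, gaussDensity (fun i => (lam i : ℝ) / ν) V u =
      (∏ i, (2 * Real.pi * (lam i : ℝ) / ν) ^ (-(1 / 2) : ℝ)) *
        Real.exp (-(ν / 2) * ∑ i, comb V u i ^ 2 / lam i) := by
    intro u
    rw [gaussDensity, Finset.mul_sum, Real.exp_sum, ← Finset.prod_mul_distrib]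
    refine Finset.prod_congr rfl fun i _ => ?_
    have hl := hlam i
    have h3 : (2 * Real.pi * (lam i : ℝ) / ν) ^ (-(1 / 2) : ℝ) =
        (√(2 * Real.pi))⁻¹ * (√(lam i / ν))⁻¹ := by
      rw [Real.rpow_neg (by positivity), ← Real.sqrt_eq_rpow, mul_div_assoc,
        Real.sqrt_mul (by positivity), mul_inv]
    have h4 : -((comb V u i / √((lam i : ℝ) / ν)) ^ 2 / 2) =
        -(ν / 2) * (comb V u i ^ 2 / lam i) := by
      rw [div_pow, Real.sq_sqrt (by positivity)]
      field_simp
    rw [h3, h4]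
    ring
  simp_rw [h2]
  rw [integral_const_mul]
  have h5 : (2 * Real.pi) ^ ((s : ℝ) / 2) =
      ν ^ ((s : ℝ) / 2) * (lebBox lam V *
        ∫ u : Fin s → ℝ, Real.exp (-(ν / 2) * ∑ i, comb V u i ^ 2 / lam i)) := by
    rw [h1, ← Real.mul_rpow hν.le (by positivity)]
    congr 1
    field_simp
  have h6 : ν ^ ((s : ℝ) / 2) ≠ 0 := by positivity
  rw [beta, gam, mu, ← hνdef, h5]
  field_simp

/-- All variances `λ_i / ν` lie in `[τ, 1]`: the exponential is smallest at variance `τ` and largest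
at 1, while the prefactor lies between 1 and `1/√τ`. -/
lemma exists_beta_bounds {V : Fin s → ι → ℤ}
    (hV : LinearIndependent ℝ (fun a => intVec (V a))) {τ : ℝ} (hτ : 0 < τ) :
    ∃ c C : ℝ, 0 < c ∧ ∀ lam : ι → ℝ≥0, Admissible τ V lam →
      c ≤ beta lam V ∧ beta lam V ≤ C := by
  have hκ : (0 : ℝ) < kappa V := by
    rw [kappa_eq]
    exact_mod_cast Finset.card_pos.2
      ⟨0, (boxPoints_finite V).mem_toFinset.2 (boxPoints_nonempty V)⟩
  have hsτ : 0 < √τ := Real.sqrt_pos.2 hτ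
  have hi1 := integrable_gaussDensity (p := fun _ : ι => τ) hτ hτ (fun _ => le_rfl)
    (fun _ => le_rfl) hV
  have hi2 := integrable_gaussDensity (p := fun _ : ι => (1 : ℝ)) one_pos one_pos
    (fun _ => le_rfl) (fun _ => le_rfl) hV
  have hpos := integral_gaussDensity_pos (p := fun _ : ι => τ) hτ hτ (fun _ => le_rfl)
    (fun _ => le_rfl) hV
  refine ⟨kappa V * (√τ ^ Fintype.card ι * ∫ u, gaussDensity (fun _ : ι => τ) V u),
    kappa V * ((√τ ^ Fintype.card ι)⁻¹ * ∫ u, gaussDensity (fun _ : ι => 1) V u),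
    by positivity, ?_⟩
  rintro lam ⟨hν, hmin, -⟩
  have hlam : ∀ i, (0 : ℝ) < lam i := fun i => (mul_pos hτ hν).trans_le (hmin i)
  have hp1 : ∀ i, τ ≤ (lam i : ℝ) / total lam := fun i => (le_div_iff₀ hν).2 (hmin i)
  have hp2 : ∀ i, (lam i : ℝ) / total lam ≤ 1 := fun i =>
    (div_le_one hν).2 (coe_le_total lam i)
  have hi := integrable_gaussDensity hτ one_pos hp1 hp2 hV
  rw [beta_eq hV hlam hν]
  constructor
  · refine mul_le_mul_of_nonneg_left ?_ hκ.le
    rw [← integral_const_mul]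
    refine integral_mono (hi1.const_mul _) hi fun u => ?_
    simp only [gaussDensity]
    rw [← Finset.card_univ, ← Finset.prod_const, ← Finset.prod_mul_distrib]
    refine Finset.prod_le_prod (fun i _ => by positivity) fun i _ => ?_
    have h1 : 0 < √((lam i : ℝ) / total lam) := Real.sqrt_pos.2 (hτ.trans_le (hp1 i))
    have h2 : √((lam i : ℝ) / total lam) ≤ 1 := Real.sqrt_le_one.2 (hp2 i)
    have h3 : (comb V u i / √((lam i : ℝ) / total lam)) ^ 2 ≤ (comb V u i / √τ) ^ 2 := by
      rw [div_pow, div_pow]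
      gcongr
      exact hp1 i
    rw [mul_div_cancel₀ _ hsτ.ne']
    calc Real.exp (-((comb V u i / √τ) ^ 2 / 2)) / √(2 * Real.pi)
        ≤ Real.exp (-((comb V u i / √((lam i : ℝ) / total lam)) ^ 2 / 2)) / √(2 * Real.pi) := by
          gcongr
      _ ≤ _ := le_div_self (by positivity) h1 h2
  · refine mul_le_mul_of_nonneg_left ?_ hκ.le
    rw [← integral_const_mul]
    refine integral_mono hi (hi2.const_mul _) fun u => ?_
    simp only [gaussDensity]
    rw [← inv_pow, ← Finset.card_univ, ← Finset.prod_const, ← Finset.prod_mul_distrib]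
    refine Finset.prod_le_prod (fun i _ => by positivity) fun i _ => ?_
    have h1 : 0 < √((lam i : ℝ) / total lam) := Real.sqrt_pos.2 (hτ.trans_le (hp1 i))
    have h2 : √((lam i : ℝ) / total lam) ≤ 1 := Real.sqrt_le_one.2 (hp2 i)
    have h3 : (comb V u i / √1) ^ 2 ≤ (comb V u i / √((lam i : ℝ) / total lam)) ^ 2 := by
      rw [Real.sqrt_one, div_one, div_pow]
      exact le_div_self (sq_nonneg _) (by positivity) (pow_le_one₀ h1.le h2)
    calc Real.exp (-((comb V u i / √((lam i : ℝ) / total lam)) ^ 2 / 2)) / √(2 * Real.pi) /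
          √((lam i : ℝ) / total lam)
        ≤ Real.exp (-((comb V u i / √1) ^ 2 / 2)) / √(2 * Real.pi) / √τ := by
          gcongr
          exact hp1 i
      _ = _ := by rw [Real.sqrt_one]; ring

end Volume

end

end CondPoisson

/-! ### Rescaling, domination and the uniform limit. -/

namespace CondPoisson

noncomputable section

variable {ι : Type*} {s : ℕ}

/-- The point of the shifted lattice `t + ℤ^s` obtained by rounding `c • u`. -/
def roundShift (c : ℝ) (t u : Fin s → ℝ) : Fin s → ℝ := fun a => t a + ⌊c * u a - t a⌋

lemma abs_roundShift_sub_le (c : ℝ) (t u : Fin s → ℝ) (a : Fin s) :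
    |roundShift c t u a - c * u a| ≤ 1 := by
  have h1 := Int.floor_le (c * u a - t a)
  have h2 := Int.lt_floor_add_one (c * u a - t a)
  rw [roundShift, abs_le]
  constructor <;> linarith

lemma norm_roundShift_ge (c : ℝ) (t u : Fin s → ℝ) :
    c * ‖u‖ - 1 ≤ ‖roundShift c t u‖ := by
  have h1 : ‖c • u - roundShift c t u‖ ≤ 1 := by
    refine (pi_norm_le_iff_of_nonneg zero_le_one).2 fun a => ?_
    rw [Real.norm_eq_abs, Pi.sub_apply, abs_sub_comm]
    exact abs_roundShift_sub_le c t u a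
  have h2 := norm_sub_norm_le (c • u) (roundShift c t u)
  rw [norm_smul, Real.norm_eq_abs] at h2
  have h3 := mul_le_mul_of_nonneg_right (le_abs_self c) (norm_nonneg u)
  linarith

lemma abs_comb_roundShift_sub_le (V : Fin s → ι → ℤ) (c : ℝ) (t u : Fin s → ℝ) (i : ι) :
    |comb V (roundShift c t u) i - c * comb V u i| ≤ ∑ a, |(V a i : ℝ)| := by
  have h : comb V (roundShift c t u) i - c * comb V u i =
      ∑ a, (roundShift c t u a - c * u a) * (V a i : ℝ) := by
    rw [comb_apply, comb_apply, Finset.mul_sum, ← Finset.sum_sub_distrib]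
    exact Finset.sum_congr rfl fun a _ => by ring
  rw [h]
  refine (Finset.abs_sum_le_sum_abs _ _).trans (Finset.sum_le_sum fun a _ => ?_)
  rw [abs_mul]
  exact mul_le_of_le_one_left (abs_nonneg _) (abs_roundShift_sub_le c t u a)

lemma cast_add_latticeVec {V : Fin s → ι → ℤ} {lam : ι → ℝ≥0} {n : ι → ℤ} {t : Fin s → ℝ}
    (hn : ∀ i, (n i : ℝ) = lam i + comb V t i) (c : ℝ) (u : Fin s → ℝ) (i : ι) :
    ((n i + latticeVec V (fun a => ⌊c * u a - t a⌋) i : ℤ) : ℝ) =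
      lam i + comb V (roundShift c t u) i := by
  have h : roundShift c t u = t + fun a => (⌊c * u a - t a⌋ : ℝ) := rfl
  rw [Int.cast_add, cast_latticeVec, hn, h, map_add, Pi.add_apply]
  ring

variable [Fintype ι]

/-- The rescaled probability mass, at the point of `n + ∑ a, ℤ • V a` next to the point with
coordinates `√ν • u - t`. -/
def scaledMass (V : Fin s → ι → ℤ) (lam : ι → ℝ≥0) (n : ι → ℤ) (t u : Fin s → ℝ) : ℝ :=
  ∏ i, (√(total lam) *
    poissonMass (lam i) (n i + latticeVec V (fun a => ⌊√(total lam) * u a - t a⌋) i))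

lemma scaledMass_nonneg (V : Fin s → ι → ℤ) (lam : ι → ℝ≥0) (n : ι → ℤ) (t u : Fin s → ℝ) :
    0 ≤ scaledMass V lam n t u :=
  Finset.prod_nonneg fun _ _ =>
    mul_nonneg (Real.sqrt_nonneg _) (poissonMass_nonneg (NNReal.coe_nonneg _) _)

lemma measurable_scaledMass (V : Fin s → ι → ℤ) (lam : ι → ℝ≥0) (n : ι → ℤ) (t : Fin s → ℝ) :
    Measurable (scaledMass V lam n t) := by
  have hmeas : Measurable
      (fun (u : Fin s → ℝ) (a : Fin s) => ⌊√(total lam) * u a - t a⌋) :=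
    measurable_pi_lambda _ fun a => Int.measurable_floor.comp
      (((measurable_pi_apply a).const_mul _).sub_const _)
  exact (measurable_of_countable (fun z : Fin s → ℤ => ∏ i, (√(total lam) *
    poissonMass (lam i) (n i + latticeVec V z i)))).comp hmeas

/-- Substitute `√ν • u - t`; the shift by `t` measures positions from `λ` rather than from the
integer point `n`. -/
lemma integral_scaledMass (V : Fin s → ι → ℤ) {lam : ι → ℝ≥0} (hν : 0 < total lam) (n : ι → ℤ)
    (t : Fin s → ℝ) :
    √(total lam) ^ s * ∫ u, scaledMass V lam n t u =
      √(total lam) ^ Fintype.card ι * ∫ u : Fin s → ℝ,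
        ∏ i, poissonMass (lam i) (n i + latticeVec V (fun a => ⌊u a⌋) i) := by
  set c := √(total lam) with hc
  have hc0 : 0 < c := Real.sqrt_pos.2 hν
  set g : (Fin s → ℝ) → ℝ := fun u =>
    ∏ i, poissonMass (lam i) (n i + latticeVec V (fun a => ⌊u a⌋) i) with hg
  have h1 : ∀ u, scaledMass V lam n t u = c ^ Fintype.card ι * g (c • u - t) := by
    intro u
    rw [scaledMass, Finset.prod_mul_distrib, Finset.prod_const, Finset.card_univ]
    rfl
  simp_rw [h1]
  rw [integral_const_mul, Measure.integral_comp_smul volume (fun x => g (x - t)) c,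
    integral_sub_right_eq_self, Module.finrank_fin_fun, smul_eq_mul,
    abs_of_pos (by positivity)]
  field_simp

/-- Multiply the one-dimensional tail bounds, using `√λ_i ≤ √ν ≤ √λ_i / √τ`. Rounding moves a point
by at most 1, which costs the factor `exp a`. -/
lemma scaledMass_le {V : Fin s → ι → ℤ} {a : ℝ} (ha0 : 0 < a)
    (ha : ∀ u, a * ‖u‖ ≤ ∑ i, |comb V u i|) {τ : ℝ} (hτ : 0 < τ) {lam : ι → ℝ≥0}
    (hν : 1 ≤ total lam) (hmin : ∀ i, τ * total lam ≤ (lam i : ℝ)) (hτν : 9 ≤ τ * total lam)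
    {n : ι → ℤ} {t : Fin s → ℝ} (hn : ∀ i, (n i : ℝ) = lam i + comb V t i) (u : Fin s → ℝ) :
    scaledMass V lam n t u ≤
      (Real.exp 2 / √τ) ^ Fintype.card ι * Real.exp a * Real.exp (-(a * ‖u‖)) := by
  set c := √(total lam) with hc
  have hc1 : 1 ≤ c := Real.one_le_sqrt.2 hν
  have hc0 : 0 < c := by linarith
  have hsτ : 0 < √τ := Real.sqrt_pos.2 hτ
  set w := roundShift c t u with hw
  have h1 : ∀ i, c * poissonMass (lam i)
      (n i + latticeVec V (fun a => ⌊c * u a - t a⌋) i) ≤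
      Real.exp 2 / √τ * Real.exp (-(|comb V w i| / c)) := by
    intro i
    have hl9 : (9 : ℝ) ≤ lam i := hτν.trans (hmin i)
    have hsl : 0 < √(lam i : ℝ) := Real.sqrt_pos.2 (by linarith)
    have h2 := poissonMass_le_tail hl9 (n i + latticeVec V (fun a => ⌊c * u a - t a⌋) i)
    rw [cast_add_latticeVec hn, add_sub_cancel_left, ← hw] at h2
    have h3 : √(lam i : ℝ) ≤ c := Real.sqrt_le_sqrt (coe_le_total lam i)
    have h4 : √τ * c ≤ √(lam i : ℝ) := by
      rw [hc, ← Real.sqrt_mul hτ.le]; exact Real.sqrt_le_sqrt (hmin i)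
    have h5 : c ≤ √(lam i : ℝ) / √τ := by
      rw [le_div_iff₀ hsτ]; linarith
    have h6 := poissonMass_nonneg (NNReal.coe_nonneg (lam i))
      (n i + latticeVec V (fun a => ⌊c * u a - t a⌋) i)
    calc c * poissonMass (lam i) (n i + latticeVec V (fun a => ⌊c * u a - t a⌋) i)
        ≤ √(lam i : ℝ) / √τ *
          poissonMass (lam i) (n i + latticeVec V (fun a => ⌊c * u a - t a⌋) i) := by gcongr
      _ = (√(lam i : ℝ) *
          poissonMass (lam i) (n i + latticeVec V (fun a => ⌊c * u a - t a⌋) i)) / √τ := by ring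
      _ ≤ Real.exp 2 * Real.exp (-(|comb V w i| / √(lam i : ℝ))) / √τ := by gcongr
      _ ≤ Real.exp 2 * Real.exp (-(|comb V w i| / c)) / √τ := by gcongr
      _ = _ := by ring
  calc scaledMass V lam n t u
      ≤ ∏ i, (Real.exp 2 / √τ * Real.exp (-(|comb V w i| / c))) :=
        Finset.prod_le_prod (fun i _ => mul_nonneg hc0.le
          (poissonMass_nonneg (NNReal.coe_nonneg _) _)) fun i _ => h1 i
    _ = (Real.exp 2 / √τ) ^ Fintype.card ι * Real.exp (-((∑ i, |comb V w i|) / c)) := by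
        rw [Finset.prod_mul_distrib, Finset.prod_const, ← Real.exp_sum, Finset.sum_neg_distrib,
          Finset.sum_div, Finset.card_univ]
    _ ≤ (Real.exp 2 / √τ) ^ Fintype.card ι * Real.exp (a + -(a * ‖u‖)) := by
        gcongr
        have h2 : a * (c * ‖u‖ - 1) ≤ ∑ i, |comb V w i| :=
          (mul_le_mul_of_nonneg_left (norm_roundShift_ge c t u) ha0.le).trans (ha w)
        have h3 : a * ‖u‖ - a ≤ (∑ i, |comb V w i|) / c := by
          rw [le_div_iff₀ hc0]
          nlinarith
        linarith
    _ = _ := by rw [Real.exp_add]; ring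

lemma tendsto_prod_sub_prod {κ α : Type*} {l : Filter α} (S : Finset κ) {f g : κ → α → ℝ}
    (hfg : ∀ i ∈ S, Tendsto (fun x => f i x - g i x) l (𝓝 0))
    (hg : ∀ i ∈ S, g i =O[l] (fun _ => (1 : ℝ))) :
    Tendsto (fun x => ∏ i ∈ S, f i x - ∏ i ∈ S, g i x) l (𝓝 0) := by
  classical
  suffices h : ((fun x => ∏ i ∈ S, f i x - ∏ i ∈ S, g i x) =o[l] (fun _ => (1 : ℝ))) ∧
      (fun x => ∏ i ∈ S, g i x) =O[l] (fun _ => (1 : ℝ)) from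
    (Asymptotics.isLittleO_one_iff ℝ).1 h.1
  induction S using Finset.induction_on with
  | empty => simp [Asymptotics.isBigO_refl, tendsto_const_nhds]
  | insert j S hj ih =>
    obtain ⟨ih1, ih2⟩ := ih (fun i hi => hfg i (Finset.mem_insert_of_mem hi))
      fun i hi => hg i (Finset.mem_insert_of_mem hi)
    have h1 := (Asymptotics.isLittleO_one_iff ℝ).2 (hfg j (Finset.mem_insert_self j S))
    have h2 := hg j (Finset.mem_insert_self j S)
    constructor
    · have h3 := ((h1.mul ih1).add (h1.mul_isBigO ih2)).add (h2.mul_isLittleO ih1)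
      simp only [mul_one] at h3
      refine h3.congr_left fun x => ?_
      rw [Finset.prod_insert hj, Finset.prod_insert hj]
      ring
    · simpa [Finset.prod_insert hj] using h2.mul ih2

section Limit

variable {l : Filter (ι → ℝ≥0)} {V : Fin s → ι → ℤ} {τ : ℝ}
  {n : (ι → ℝ≥0) → ι → ℤ} {t : (ι → ℝ≥0) → Fin s → ℝ}

/-- Rounding displaces the standardized coordinate by `O(1/√λ_i)`, so the local limit applies to
each factor. The ratio `√ν / √λ_i` stays below `1/√τ`. -/
lemma tendsto_scaledMass_sub (hτ : 0 < τ) (hl : Tendsto total l atTop)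
    (hmin : ∀ᶠ lam in l, ∀ i, τ * total lam ≤ (lam i : ℝ))
    (hn : ∀ᶠ lam in l, ∀ i, (n lam i : ℝ) = lam i + comb V (t lam) i) (u : Fin s → ℝ) :
    Tendsto (fun lam => scaledMass V lam (n lam) (t lam) u -
      gaussDensity (fun i => (lam i : ℝ) / total lam) V u) l (𝓝 0) := by
  have hsτ : 0 < √τ := Real.sqrt_pos.2 hτ
  have hpos : ∀ᶠ lam in l, 0 < total lam := hl.eventually_gt_atTop 0
  have hinv : ∀ᶠ lam in l, ∀ i, (√((lam i : ℝ) / total lam))⁻¹ ≤ (√τ)⁻¹ := by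
    filter_upwards [hpos, hmin] with lam h1 h2 i
    gcongr
    exact (le_div_iff₀ h1).2 (h2 i)
  refine tendsto_prod_sub_prod _ (fun i _ => ?_) fun i _ => ?_
  · have hlam : Tendsto (fun lam : ι → ℝ≥0 => (lam i : ℝ)) l atTop :=
      tendsto_atTop_mono' l (hmin.mono fun lam h => h i) (hl.const_mul_atTop hτ)
    have hx : ∀ᶠ lam in l,
        |comb V u i / √((lam i : ℝ) / total lam)| ≤ |comb V u i| * (√τ)⁻¹ := by
      filter_upwards [hinv] with lam h
      rw [div_eq_mul_inv, abs_mul, abs_inv, abs_of_nonneg (Real.sqrt_nonneg _)]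
      exact mul_le_mul_of_nonneg_left (h i) (abs_nonneg _)
    have hm : Tendsto (fun lam : ι → ℝ≥0 => (((n lam i + latticeVec V
        (fun a => ⌊√(total lam) * u a - t lam a⌋) i : ℤ) : ℝ) - lam i) / √(lam i : ℝ) -
          comb V u i / √((lam i : ℝ) / total lam)) l (𝓝 0) := by
      have h0 : Tendsto (fun lam : ι → ℝ≥0 => (∑ a, |(V a i : ℝ)|) / √(lam i : ℝ)) l (𝓝 0) :=
        (Real.tendsto_sqrt_atTop.comp hlam).const_div_atTop _
      refine squeeze_zero_norm' ?_ h0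
      filter_upwards [hn, hlam.eventually_gt_atTop 0] with lam h1 h2
      rw [cast_add_latticeVec h1, add_sub_cancel_left, Real.sqrt_div (NNReal.coe_nonneg _),
        div_div_eq_mul_div, ← sub_div, norm_div, Real.norm_eq_abs, Real.norm_eq_abs,
        abs_of_nonneg (Real.sqrt_nonneg _), mul_comm (comb V u i)]
      gcongr
      exact abs_comb_roundShift_sub_le V _ _ u i
    have h1 := tendsto_sqrt_mul_poissonMass hlam hx hm
    have h2 := h1.zero_mul_isBoundedUnder_le
      (g := fun lam : ι → ℝ≥0 => (√((lam i : ℝ) / total lam))⁻¹) ⟨(√τ)⁻¹, by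
        rw [eventually_map]
        filter_upwards [hinv] with lam h
        simp only [Function.comp, Real.norm_eq_abs]
        rw [abs_of_nonneg (by positivity)]
        exact h i⟩
    refine h2.congr' ?_
    filter_upwards [hpos, hlam.eventually_gt_atTop 0] with lam h3 h4
    have h5 : 0 < √(lam i : ℝ) := Real.sqrt_pos.2 h4
    have h6 : √(total lam) = √(lam i : ℝ) * (√((lam i : ℝ) / total lam))⁻¹ := by
      rw [Real.sqrt_div h4.le]; field_simp
    have h7 : ∀ q, √(total lam) * q = √(lam i : ℝ) * (√((lam i : ℝ) / total lam))⁻¹ * q :=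
      fun q => by rw [← h6]
    rw [h7]
    ring
  · refine Asymptotics.isBigO_iff.2 ⟨(√(2 * Real.pi))⁻¹ * (√τ)⁻¹, ?_⟩
    filter_upwards [hinv] with lam h
    rw [Real.norm_eq_abs, abs_of_nonneg (by positivity), norm_one, mul_one, div_eq_mul_inv,
      div_eq_mul_inv]
    refine mul_le_mul ?_ (h i) (by positivity) (by positivity)
    exact mul_le_of_le_one_left (by positivity) (Real.exp_le_one_iff.2
        (neg_nonpos.2 (by positivity)))

lemma tendsto_integral_scaledMass_sub [l.IsCountablyGenerated]
    (hV : LinearIndependent ℝ (fun a => intVec (V a))) (hτ : 0 < τ) (hl : Tendsto total l atTop)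
    (hmin : ∀ᶠ lam in l, ∀ i, τ * total lam ≤ (lam i : ℝ))
    (hn : ∀ᶠ lam in l, ∀ i, (n lam i : ℝ) = lam i + comb V (t lam) i) :
    Tendsto (fun lam => (∫ u, scaledMass V lam (n lam) (t lam) u) -
      ∫ u, gaussDensity (fun i => (lam i : ℝ) / total lam) V u) l (𝓝 0) := by
  obtain ⟨a, ha0, ha⟩ := exists_mul_norm_le_sum_abs_comb hV
  have hint := integrable_exp_neg_mul_norm (s := s) ha0
  set K1 := (Real.exp 2 / √τ) ^ Fintype.card ι * Real.exp a with hK1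
  set K2 := (Real.exp (1 / 2) / √τ) ^ Fintype.card ι with hK2
  have hgood : ∀ᶠ lam in l, (∀ u, scaledMass V lam (n lam) (t lam) u ≤
        K1 * Real.exp (-(a * ‖u‖))) ∧
      (∀ u, gaussDensity (fun i => (lam i : ℝ) / total lam) V u ≤ K2 * Real.exp (-(a * ‖u‖))) ∧
      ∀ u, 0 < gaussDensity (fun i => (lam i : ℝ) / total lam) V u := by
    filter_upwards [hl.eventually_ge_atTop 1, hmin, hn,
      (hl.const_mul_atTop hτ).eventually_ge_atTop 9] with lam h1 h2 h3 h4
    have hν : 0 < total lam := by linarith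
    have hp1 : ∀ i, τ ≤ (lam i : ℝ) / total lam := fun i => (le_div_iff₀ hν).2 (h2 i)
    refine ⟨scaledMass_le ha0 ha hτ h1 h2 h4 h3, fun u => ?_,
      gaussDensity_pos (fun i => hτ.trans_le (hp1 i)) V⟩
    have := gaussDensity_le hτ hp1 (M := 1) (fun i => (div_le_one hν).2 (coe_le_total lam i)) ha u
    rwa [Real.sqrt_one, div_one] at this
  have h0 := tendsto_integral_filter_of_dominated_convergence
    (F := fun lam u => scaledMass V lam (n lam) (t lam) u -
      gaussDensity (fun i => (lam i : ℝ) / total lam) V u) (f := fun _ => (0 : ℝ)) (l := l)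
    (μ := (volume : Measure (Fin s → ℝ)))
    (fun u => K1 * Real.exp (-(a * ‖u‖)) + K2 * Real.exp (-(a * ‖u‖)))
    (Eventually.of_forall fun lam => (measurable_scaledMass V lam _ _).aestronglyMeasurable.sub
      (continuous_gaussDensity _ V).aestronglyMeasurable)
    (hgood.mono fun lam h => Eventually.of_forall fun u => by
      have h1 := scaledMass_nonneg V lam (n lam) (t lam) u
      have h2 := h.1 u
      have h3 := h.2.1 u
      have h4 := h.2.2 u
      rw [Real.norm_eq_abs, abs_le]
      constructor <;> linarith)
    ((hint.const_mul K1).add (hint.const_mul K2))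
    (Eventually.of_forall fun u => tendsto_scaledMass_sub hτ hl hmin hn u)
  rw [integral_zero] at h0
  refine h0.congr' ?_
  filter_upwards [hgood] with lam h
  refine integral_sub ?_ ?_
  · refine (hint.const_mul K1).mono' (measurable_scaledMass V lam _ _).aestronglyMeasurable
      (Eventually.of_forall fun u => ?_)
    rw [Real.norm_eq_abs, abs_of_nonneg (scaledMass_nonneg V lam _ _ u)]
    exact h.1 u
  · refine (hint.const_mul K2).mono' (continuous_gaussDensity _ V).aestronglyMeasurable
      (Eventually.of_forall fun u => ?_)
    rw [Real.norm_eq_abs, abs_of_pos (h.2.2 u)]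
    exact h.2.1 u

end Limit

/-- The local limit theorem for Poisson vectors on `λ ⊕ L`, uniformly in the admissible `λ`. -/
theorem poisson_plane_asymptotics [DecidableEq ι] {V : Fin s → ι → ℤ}
    (hV : LinearIndependent ℝ (fun a => intVec (V a))) {τ : ℝ} (hτ : 0 < τ) {ε : ℝ}
    (hε : 0 < ε) :
    ∃ N : ℝ, ∀ lam : ι → ℝ≥0, Admissible τ V lam → N ≤ total lam →
      ∀ (Ω : Type*) [MeasurableSpace Ω] (P : Measure Ω) [IsProbabilityMeasure P]
        (Y : ι → Ω → ℕ), IsIndepPoisson P Y lam →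
        |total lam ^ (((Fintype.card ι : ℝ) - s) / 2) *
          P.real {ω | natVec (fun i => Y i ω) ∈ plane lam V} - beta lam V| ≤ ε := by
  classical
  have hex : ∀ lam : ι → ℝ≥0, ∃ m : ι → ℤ, Admissible τ V lam → intVec m ∈ plane lam V := by
    intro lam
    by_cases h : Admissible τ V lam
    · exact ⟨h.2.2.choose, fun _ => h.2.2.choose_spec⟩
    -- A dummy value off the admissible set makes `m` a function of every `λ`, as limits along a
    -- filter require.
    · exact ⟨0, fun h' => absurd h' h⟩
  choose m hm using hex
  have hext : ∀ (r : ι → ℤ) (lam : ι → ℝ≥0), ∃ t : Fin s → ℝ, Admissible τ V lam →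
      r ∈ boxPoints V → ∀ i, ((m lam i + r i : ℤ) : ℝ) = lam i + comb V t i := by
    intro r lam
    by_cases h : Admissible τ V lam ∧ r ∈ boxPoints V
    · obtain ⟨v, hv⟩ := intVec_mem_plane_iff.1 (hm lam h.1)
      obtain ⟨t, -, ht⟩ := intVec_mem_box_iff.1 h.2
      refine ⟨v + t, fun _ _ i => ?_⟩
      rw [Int.cast_add, hv, ht, map_add, Pi.add_apply, add_assoc]
    · exact ⟨0, fun h1 h2 => absurd ⟨h1, h2⟩ h⟩
  choose t ht using hext
  -- An eventual statement along this filter is exactly one with a threshold `N` uniform over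
  -- admissible `λ`.
  set l : Filter (ι → ℝ≥0) := comap total atTop ⊓ 𝓟 {lam | Admissible τ V lam} with hl
  have hadm : ∀ᶠ lam in l, Admissible τ V lam := mem_inf_of_right (mem_principal_self _)
  have htot : Tendsto total l atTop := tendsto_comap.mono_left inf_le_left
  have hlim : Tendsto (fun lam => ∑ r ∈ (boxPoints_finite V).toFinset,
      ((∫ u, scaledMass V lam (fun i => m lam i + r i) (t r lam) u) -
        ∫ u, gaussDensity (fun i => (lam i : ℝ) / total lam) V u)) l (𝓝 0) := by
    rw [← Finset.sum_const_zero (s := (boxPoints_finite V).toFinset)]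
    refine tendsto_finsetSum _ fun r hr => ?_
    refine tendsto_integral_scaledMass_sub hV hτ htot (hadm.mono fun lam h => h.2.1)
      (hadm.mono fun lam h => ht r lam h ((boxPoints_finite V).mem_toFinset.1 hr))
  have hev := hlim.eventually (Metric.closedBall_mem_nhds 0 hε)
  rw [hl, eventually_inf_principal, eventually_comap] at hev
  obtain ⟨N, hN⟩ := eventually_atTop.1 hev
  refine ⟨N, fun lam ha hNlam Ω _ P _ Y hY => ?_⟩
  have h1 := hN _ hNlam lam rfl ha
  have hν := ha.1
  have hlam : ∀ i, (0 : ℝ) < lam i := fun i => (mul_pos hτ hν).trans_le (ha.2.1 i)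
  have h2 : total lam ^ (((Fintype.card ι : ℝ) - s) / 2) *
      P.real {ω | natVec (fun i => Y i ω) ∈ plane lam V} =
      ∑ r ∈ (boxPoints_finite V).toFinset,
        ∫ u, scaledMass V lam (fun i => m lam i + r i) (t r lam) u := by
    rw [hY.measureReal_plane hV (hm lam ha), Finset.mul_sum]
    refine Finset.sum_congr rfl fun r _ => ?_
    have h3 := integral_scaledMass V hν (fun i => m lam i + r i) (t r lam)
    have hc : 0 < √(total lam) := Real.sqrt_pos.2 hν
    rw [sub_div, Real.rpow_sub hν, Real.rpow_div_two_eq_sqrt _ hν.le,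
      Real.rpow_div_two_eq_sqrt _ hν.le, Real.rpow_natCast, Real.rpow_natCast,
      div_mul_eq_mul_div, ← h3]
    field_simp
  rw [h2, beta_eq hV hlam hν, kappa_eq, ← nsmul_eq_mul, ← Finset.sum_const,
    ← Finset.sum_sub_distrib]
  change dist _ _ ≤ _ at h1
  rw [Real.dist_0_eq_abs] at h1
  exact h1

end

end CondPoisson

/-! ### Tables with equal margins. -/

namespace CondPoisson

noncomputable section

variable {k : ℕ}

/-- The integer vector `e_i - e_k` in `ℤ^(k+1)`. -/
def rootVec (i : Fin k) (a : Fin (k + 1)) : ℤ :=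
  (if a = i.castSucc then 1 else 0) - if a = Fin.last k then 1 else 0

lemma rootVec_castSucc (i a : Fin k) : rootVec i a.castSucc = if a = i then 1 else 0 := by
  simp [rootVec, Fin.castSucc_ne_last]

lemma rootVec_last (i : Fin k) : rootVec i (Fin.last k) = -1 := by
  simp [rootVec, (Fin.castSucc_ne_last i).symm]

lemma sum_rootVec (i : Fin k) : ∑ a, rootVec i a = 0 := by
  simp [rootVec]

lemma sum_mul_rootVec_castSucc (f : Fin k → ℝ) (a : Fin k) :
    ∑ i, f i * (rootVec i a.castSucc : ℝ) = f a := by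
  simp [rootVec_castSucc]

/-- A vector of sum zero is determined by all entries but the last, and these are its coefficients.
-/
lemma sum_mul_rootVec (f : Fin (k + 1) → ℝ) (hf : ∑ a, f a = 0) (a : Fin (k + 1)) :
    ∑ i : Fin k, f i.castSucc * (rootVec i a : ℝ) = f a := by
  induction a using Fin.lastCases with
  | cast a => exact sum_mul_rootVec_castSucc (fun i => f i.castSucc) a
  | last =>
    rw [Fin.sum_univ_castSucc] at hf
    simp only [rootVec_last, Int.cast_neg, Int.cast_one, mul_neg, mul_one,
      Finset.sum_neg_distrib]
    linarith

/-- A basis of the space of square matrices with vanishing row sums and column sums. -/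
def tableVec (k : ℕ) (p : Fin (k * k)) (ij : Fin (k + 1) × Fin (k + 1)) : ℤ :=
  rootVec (finProdFinEquiv.symm p).1 ij.1 * rootVec (finProdFinEquiv.symm p).2 ij.2

lemma comb_tableVec (u : Fin k → Fin k → ℝ) (a b : Fin (k + 1)) :
    comb (tableVec k)
        (fun p => u (finProdFinEquiv.symm p).1 (finProdFinEquiv.symm p).2) (a, b) =
      ∑ i, (∑ j, u i j * (rootVec j b : ℝ)) * (rootVec i a : ℝ) := by
  rw [comb_apply, ← finProdFinEquiv.sum_comp, Fintype.sum_prod_type]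
  refine Finset.sum_congr rfl fun i _ => ?_
  rw [Finset.sum_mul]
  refine Finset.sum_congr rfl fun j _ => ?_
  simp only [tableVec, Equiv.symm_apply_apply]
  push_cast
  ring

lemma exists_uncurry (v : Fin (k * k) → ℝ) : ∃ u : Fin k → Fin k → ℝ,
    v = fun p => u (finProdFinEquiv.symm p).1 (finProdFinEquiv.symm p).2 :=
  ⟨fun i j => v (finProdFinEquiv (i, j)),
    funext fun p => congrArg v (finProdFinEquiv.apply_symm_apply p).symm⟩

/-- Each coefficient reappears as an entry outside the last row and column. -/
lemma linearIndependent_tableVec (k : ℕ) :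
    LinearIndependent ℝ (fun p => intVec (tableVec k p)) := by
  rw [Fintype.linearIndependent_iff]
  intro v hv p
  obtain ⟨u, rfl⟩ := exists_uncurry v
  rw [sum_smul_intVec] at hv
  have h := congrArg (fun y : EuclideanSpace ℝ (Fin (k + 1) × Fin (k + 1)) =>
    y ((finProdFinEquiv.symm p).1.castSucc, (finProdFinEquiv.symm p).2.castSucc)) hv
  simp only [comb_tableVec, sum_mul_rootVec_castSucc] at h
  exact h

/-- After subtracting the mean, the margins vanish. Applying `sum_mul_rootVec` to rows and then
columns expands such a matrix in `tableVec`; conversely each `rootVec` sums to zero. -/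
lemma mem_tables_iff (n : ℕ) (T : Fin (k + 1) × Fin (k + 1) → ℕ) :
    T ∈ tables (k + 1) n ↔
      natVec T ∈ plane (fun _ => (n : ℝ≥0) / ((k + 1 : ℕ) : ℝ≥0) ^ 2) (tableVec k) := by
  have hT : natVec T = intVec fun ij => (T ij : ℤ) := by simp [natVec, intVec]
  have hk : ((k : ℝ) + 1) ≠ 0 := by positivity
  rw [hT, intVec_mem_plane_iff]
  simp only [tables, Set.mem_ofPred_eq, Int.cast_natCast, NNReal.coe_div, NNReal.coe_natCast,
    NNReal.coe_pow]
  push_cast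
  set q : ℝ := (n : ℝ) / ((k : ℝ) + 1) ^ 2 with hq
  have hsum : ∀ f : Fin (k + 1) → ℝ,
      ∑ a, f a = (n : ℝ) / ((k : ℝ) + 1) ↔ ∑ a, (f a - q) = 0 := by
    intro f
    rw [Finset.sum_sub_distrib, sub_eq_zero]
    simp only [Finset.sum_const, Finset.card_univ, Fintype.card_fin, nsmul_eq_mul]
    have : ((k + 1 : ℕ) : ℝ) * q = (n : ℝ) / ((k : ℝ) + 1) := by
      rw [hq]; push_cast; field_simp
    rw [this]
  simp_rw [hsum]
  constructor
  · rintro ⟨hrow, hcol⟩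
    refine ⟨fun p => T ((finProdFinEquiv.symm p).1.castSucc,
      (finProdFinEquiv.symm p).2.castSucc) - q, ?_⟩
    rintro ⟨a, b⟩
    rw [comb_tableVec (fun i j => (T (i.castSucc, j.castSucc) : ℝ) - q)]
    have h1 : ∀ i : Fin k, ∑ j : Fin k, ((T (i.castSucc, j.castSucc) : ℝ) - q) *
        (rootVec j b : ℝ) = T (i.castSucc, b) - q := fun i =>
      sum_mul_rootVec (fun b => (T (i.castSucc, b) : ℝ) - q) (hrow _) b
    simp_rw [h1]
    rw [sum_mul_rootVec (fun a => (T (a, b) : ℝ) - q) (hcol b) a]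
    ring
  · rintro ⟨v, hv⟩
    obtain ⟨u, rfl⟩ := exists_uncurry v
    have h0 : ∀ i : Fin k, ∑ a, (rootVec i a : ℝ) = 0 := fun i => by
      exact_mod_cast sum_rootVec i
    have h1 : ∀ a b, (T (a, b) : ℝ) - q =
        ∑ i, (∑ j, u i j * (rootVec j b : ℝ)) * (rootVec i a : ℝ) := by
      intro a b
      rw [hv (a, b), comb_tableVec]
      ring
    simp_rw [h1]
    refine ⟨fun a => ?_, fun b => ?_⟩
    · rw [Finset.sum_comm]
      refine Finset.sum_eq_zero fun i _ => ?_
      rw [← Finset.sum_mul, Finset.sum_comm]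
      simp_rw [← Finset.mul_sum, h0]
      simp
    · rw [Finset.sum_comm]
      simp_rw [← Finset.mul_sum, h0]
      simp

lemma total_const {ι : Type*} [Fintype ι] (x : ℝ≥0) :
    total (fun _ : ι => x) = Fintype.card ι * x := by
  simp [total]

lemma total_tables (n : ℕ) :
    total (fun _ : Fin (k + 1) × Fin (k + 1) => (n : ℝ≥0) / ((k + 1 : ℕ) : ℝ≥0) ^ 2) = n := by
  rw [total_const]
  simp
  field_simp

lemma admissible_tables {n : ℕ} (hn : 0 < n) (hkn : k + 1 ∣ n) :
    Admissible (1 / ((k : ℝ) + 1) ^ 2) (tableVec k)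
      (fun _ => (n : ℝ≥0) / ((k + 1 : ℕ) : ℝ≥0) ^ 2) := by
  refine ⟨?_, fun i => ?_, ?_⟩
  · rw [total_tables]; exact_mod_cast hn
  · rw [total_tables]
    simp
    field_simp
    rfl
  · obtain ⟨m, rfl⟩ := hkn
    have hk : ((k : ℝ) + 1) ≠ 0 := by positivity
    -- The scalar matrix `m • 1` is an integer table with the required margins; this is where
    -- divisibility enters.
    refine ⟨fun ij => if ij.1 = ij.2 then (m : ℤ) else 0, ?_⟩
    have h := (mem_tables_iff ((k + 1) * m) (fun ij : Fin (k + 1) × Fin (k + 1) =>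
      if ij.1 = ij.2 then m else 0)).1 (by
        constructor <;> intro i <;> simp <;> field_simp)
    convert h using 1
    ext ij
    simp [natVec, intVec]

/-- By `beta_eq`, `β` depends on `λ` only through `λ / ν`. -/
lemma beta_const {ι : Type*} [Fintype ι] [DecidableEq ι] [Nonempty ι] {s : ℕ}
    {V : Fin s → ι → ℤ} (hV : LinearIndependent ℝ (fun a => intVec (V a))) {x : ℝ≥0}
    (hx : 0 < x) : beta (fun _ => x) V = beta (fun _ => 1) V := by
  have hc : (0 : ℝ) < Fintype.card ι := by exact_mod_cast Fintype.card_pos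
  have hx' : (0 : ℝ) < x := hx
  rw [beta_eq hV (fun _ => hx') (by rw [total_const]; positivity),
    beta_eq hV (fun _ => by simp) (by rw [total_const]; simpa using hc), total_const, total_const]
  congr 3
  funext u
  congr 1
  funext i
  simp only [NNReal.coe_one]
  field_simp

end

end CondPoisson

/-! ### Assembly of both parts. -/

open CondPoisson in
theorem mainTheorem4 :
    (∀ (q s : ℕ) (V : Fin s → Fin q → ℤ),
      LinearIndependent ℝ (fun a => CondPoisson.intVec (V a)) →
      ∀ τ : ℝ, 0 < τ →
        (∃ c C : ℝ, 0 < c ∧ ∀ lam : Fin q → ℝ≥0, CondPoisson.Admissible τ V lam →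
          c ≤ CondPoisson.beta lam V ∧ CondPoisson.beta lam V ≤ C) ∧
        (∀ ε : ℝ, 0 < ε → ∃ N : ℝ, ∀ lam : Fin q → ℝ≥0, CondPoisson.Admissible τ V lam →
          N ≤ CondPoisson.total lam →
          ∀ (Ω : Type*) [MeasurableSpace Ω] (P : Measure Ω) [IsProbabilityMeasure P]
            (Y : Fin q → Ω → ℕ), CondPoisson.IsIndepPoisson P Y lam →
            ∃ r : ℝ, |r| ≤ ε ∧
              P.real {ω | CondPoisson.natVec (fun i => Y i ω) ∈ CondPoisson.plane lam V} =
                CondPoisson.total lam ^ (-(((q : ℝ) - (s : ℝ)) / 2)) *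
                  (CondPoisson.beta lam V + r))) ∧
    (∀ k : ℕ, 1 ≤ k → ∃ b : ℝ, 0 < b ∧
      ∀ ε : ℝ, 0 < ε → ∃ N : ℕ, ∀ n : ℕ, N ≤ n → k ∣ n →
        ∀ (Ω : Type*) [MeasurableSpace Ω] (P : Measure Ω) [IsProbabilityMeasure P]
          (Y : Fin k × Fin k → Ω → ℕ),
          CondPoisson.IsIndepPoisson P Y (fun _ => (n : ℝ≥0) / (k : ℝ≥0) ^ 2) →
          |(n : ℝ) ^ ((2 * (k : ℝ) - 1) / 2) *
              P.real {ω | (fun ij => Y ij ω) ∈ CondPoisson.tables k n} - b| ≤ ε) := by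
  refine ⟨fun q s V hV τ hτ => ⟨exists_beta_bounds hV hτ, fun ε hε => ?_⟩, fun k hk => ?_⟩
  · obtain ⟨N, hN⟩ := poisson_plane_asymptotics hV hτ hε
    refine ⟨N, fun lam ha hNlam Ω _ P _ Y hY => ⟨_, hN lam ha hNlam Ω P Y hY, ?_⟩⟩
    rw [add_sub_cancel, ← mul_assoc, ← Real.rpow_add ha.1, Fintype.card_fin, neg_add_cancel,
      Real.rpow_zero, one_mul]
  · obtain ⟨k, rfl⟩ := Nat.exists_eq_add_of_le' hk
    have hV := linearIndependent_tableVec k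
    have hτ : 0 < 1 / ((k : ℝ) + 1) ^ 2 := by positivity
    have hβ : ∀ n : ℕ, 0 < n → beta (fun _ => (n : ℝ≥0) / ((k + 1 : ℕ) : ℝ≥0) ^ 2) (tableVec k) =
        beta (fun _ => 1) (tableVec k) := fun n hn => by
      have hn' : (0 : ℝ≥0) < n := by exact_mod_cast hn
      exact beta_const hV (by positivity)
    refine ⟨beta (fun _ => 1) (tableVec k), ?_, fun ε hε => ?_⟩
    · obtain ⟨c, _, hc, h⟩ := exists_beta_bounds hV hτ
      rw [← hβ (k + 1) k.succ_pos]
      exact hc.trans_le (h _ (admissible_tables k.succ_pos dvd_rfl)).1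
    · obtain ⟨N, hN⟩ := poisson_plane_asymptotics hV hτ hε
      -- The 1 excludes `n = 0`, where the total mean vanishes.
      refine ⟨max 1 ⌈N⌉₊, fun n hn hkn Ω _ P _ Y hY => ?_⟩
      have hn0 : 0 < n := (le_max_left _ _).trans hn
      have hNn : N ≤ n := Nat.ceil_le.1 ((le_max_right _ _).trans hn)
      have h := hN _ (admissible_tables hn0 hkn) (by rwa [total_tables]) Ω P Y hY
      rw [total_tables, hβ n hn0] at h
      -- With `K = k + 1`, the codimension is `K² - (K - 1)² = 2K - 1`.
      have he : ((Fintype.card (Fin (k + 1) × Fin (k + 1)) : ℝ) - (k * k : ℕ)) / 2 =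
          (2 * ((k + 1 : ℕ) : ℝ) - 1) / 2 := by
        simp only [Fintype.card_prod, Fintype.card_fin]
        push_cast
        ring
      rw [he] at h
      simp_rw [mem_tables_iff]
      exact h
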